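/- Let $k$ be a field and let $Q$ be a finite quiver whose underlying graph is a tree (so $Q$ has no loops and at most one arrow between two vertices). Call a vertex of $Q$ a crossing if its entry degree or its exit degree is at least $2$, and call $Q$ an admissible tree quiver if every crossing of $Q$ is a sink or a source. For a finite-dimensional module $U$ over a $k$-algebra $A$, the projection functor $F_U\colon \mathrm{mod}\,A\to\mathrm{mod}\,A$ on finite-dimensional left $A$-modules sends $M$ to $M/\sigma_U(M)$, where $\sigma_U(M)$ is the greatest submodule of $M$ which is a quotient of some $U^{\oplus d}$, and sends a homomorphism to the induced one. Let $M(Q)$ be the monoid of isomorphism classes of endofunctors of $\mathrm{mod}\,kQ$ generated, under composition ($[F][G]=[F\circ G]$), by the classes $[F_S]$ with $S$ a simple module over the path algebra $kQ$ (paths are composed from right to left, so that left $kQ$-modules are representations of $Q$). For a vertex $t$ put $F_t=F_{S_t}$, where $S_t$ is the simple module attached to $t$, and for a word $w=t_1t_2\cdots t_r$ over the vertex set $Q_0$ put $F_w=F_{t_1}\circ\cdots\circ F_{t_r}$. Let $B_Q$ be the $k$-algebra with generators $X_t$, $t\in Q_0$, and relations $$X_s^2=X_s\ (s\in Q_0),\qquad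 X_sX_tX_s=X_tX_sX_t\ (s,t\in Q_0),\qquad X_tX_sX_t=X_sX_t\ \text{ if there is no arrow from } t \text{ to } s,$$ and let $X_w=X_{t_1}\cdots X_{t_r}$. A set $W$ of words over $Q_0$ is an admissible normal form associated with $Q$ if (1) $W$ contains the empty word and all one-letter words; (2) $\{X_w\mid w\in W\}\subseteq B_Q$ is closed under right multiplication with every $X_t$; (3) for all $v\neq w$ in $W$ there is a finite-dimensional $kQ$-module $V$ with $F_vV\not\cong F_wV$. Theorem. Let $Q$ be an admissible tree quiver. Then there is an admissible normal form associated with $Q$. In particular the above relations are defining for $M(Q)$: the assignment $X_t\mapsto [F_t]$ induces an isomorphism from the monoid with generators $X_t$ $(t\in Q_0)$ and these relations onto $M(Q)$, and an isomorphism of $k$-algebras $B_Q\cong kM(Q)$. -/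

import Mathlib

open CategoryTheory

universe u v w

namespace ProjFun

/-! ### Finite-dimensional modules and projection functors -/

section Projection

open scoped ModuleCat

variable (k : Type w) [Field k] (A : Type u) [Ring A] [Algebra k A]

/-- The category of (left) `A`-modules that are finite-dimensional over `k`. -/
abbrev FDMod :=
  ObjectProperty.FullSubcategory
    (fun M : ModuleCat.{w} A => FiniteDimensional k M)

/-- `N` lies in `gen U`: it is isomorphic to a quotient of some `U ^ d`. -/
def Gen (U N : Type*) [AddCommGroup U] [Module A U] [AddCommGroup N] [Module A N] : Prop :=
  ∃ (d : ℕ) (f : (Fin d → U) →ₗ[A] N), Function.Surjective f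

/-- The supremum of the submodules of `M` that lie in `gen U`. For noetherian (in particular for
finite-dimensional) `M` it is the greatest such submodule, see `isGreatest_genPart`. -/
def genPart (U M : Type*) [AddCommGroup U] [Module A U] [AddCommGroup M] [Module A M] :
    Submodule A M :=
  sSup {N : Submodule A M | Gen A U N}

variable {A} in
theorem genPart_le_comap {U M N : Type*} [AddCommGroup U] [Module A U] [AddCommGroup M]
    [Module A M] [AddCommGroup N] [Module A N] (f : M →ₗ[A] N) :
    genPart A U M ≤ (genPart A U N).comap f := by
  refine sSup_le fun X hX => ?_
  rw [← Submodule.map_le_iff_le_comap]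
  refine le_sSup ?_
  obtain ⟨d, g, hg⟩ := hX
  refine ⟨d, (f.submoduleMap X).comp g, ?_⟩
  rw [LinearMap.coe_comp]
  exact (LinearMap.submoduleMap_surjective f X).comp hg

theorem isGreatest_genPart (U M : Type*) [AddCommGroup U] [Module A U] [AddCommGroup M]
    [Module A M] [IsNoetherian A M] :
    IsGreatest {N : Submodule A M | Gen A U N} (genPart A U M) := by
  refine ⟨?_, fun X hX => le_sSup hX⟩
  have hc : CompleteLattice.IsSupClosedCompact (Submodule A M) :=
    CompleteLattice.isSupClosedCompact_iff_wellFoundedGT (Submodule A M) |>.2 inferInstance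
  refine hc _ ⟨⊥, 0, 0, fun x => ⟨0, Subsingleton.elim _ _⟩⟩ ?_
  rintro X ⟨d, f, hf⟩ Y ⟨e, g, hg⟩
  let i : (Fin (d + e) → U) →ₗ[A] (Fin d → U) := LinearMap.funLeft A U (Fin.castAdd e)
  let j : (Fin (d + e) → U) →ₗ[A] (Fin e → U) := LinearMap.funLeft A U (Fin.natAdd d)
  refine ⟨d + e, (Submodule.inclusion le_sup_left).comp (f.comp i) +
    (Submodule.inclusion le_sup_right).comp (g.comp j), ?_⟩
  rintro ⟨z, hz⟩
  obtain ⟨x, hx, y, hy, rfl⟩ := Submodule.mem_sup.1 hz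
  obtain ⟨a, ha⟩ := hf ⟨x, hx⟩
  obtain ⟨b, hb⟩ := hg ⟨y, hy⟩
  refine ⟨Fin.append a b, Subtype.ext ?_⟩
  have hi : i (Fin.append a b) = a := by
    funext t; simp [i, LinearMap.funLeft_apply]
  have hj : j (Fin.append a b) = b := by
    funext t; simp [j, LinearMap.funLeft_apply]
  simp [hi, hj, ha, hb]

theorem finiteDimensional_quotient (M : ModuleCat.{w} A) [FiniteDimensional k M]
    (N : Submodule A M) : FiniteDimensional k (ModuleCat.of A (M ⧸ N)) := by
  let f : M →ₗ[k] ModuleCat.of A (M ⧸ N) :=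
    { toFun := fun x => N.mkQ x
      map_add' := fun x y => N.mkQ.map_add x y
      map_smul' := fun c x => N.mkQ.map_smul (algebraMap k A c) x }
  exact Module.Finite.of_surjective f N.mkQ_surjective

variable {A}

/-- The projection functor attached to `U`: it sends `M` to `M ⧸ genPart A U M`, and a
homomorphism to the induced homomorphism between the quotients. -/
def projFunctor (U : FDMod k A) : FDMod k A ⥤ FDMod k A where
  obj M := ⟨ModuleCat.of A (M.obj ⧸ genPart A U.obj M.obj),
    have := M.property; finiteDimensional_quotient k A M.obj _⟩
  map {M N} f := ObjectProperty.homMk (ModuleCat.ofHom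
    (Submodule.mapQ (genPart A U.obj M.obj) (genPart A U.obj N.obj) f.hom.hom
      (genPart_le_comap f.hom.hom)))
  map_id M := by
    apply ObjectProperty.hom_ext
    apply ModuleCat.hom_ext
    exact Submodule.mapQ_id _
  map_comp {M N L} f g := by
    apply ObjectProperty.hom_ext
    apply ModuleCat.hom_ext
    exact Submodule.mapQ_comp _ _ _ f.hom.hom g.hom.hom (genPart_le_comap _) (genPart_le_comap _)

end Projection

/-! ### Isomorphism classes of endofunctors, and the monoid of projection functors -/

section Monoid

/-- Isomorphism classes of endofunctors of `C`. -/
def EndoClass (C : Type u) [Category.{v} C] := Quotient (isIsomorphicSetoid (C ⥤ C))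

/-- The isomorphism class of an endofunctor. -/
def EndoClass.mk {C : Type u} [Category.{v} C] (F : C ⥤ C) : EndoClass C :=
  Quotient.mk (isIsomorphicSetoid (C ⥤ C)) F

/-- Multiplication is composition of functors: `[F] * [G] = [F ∘ G]`, where `G` acts first. -/
instance (C : Type u) [Category.{v} C] : Monoid (EndoClass C) where
  one := EndoClass.mk (𝟭 C)
  mul := Quotient.map₂ (fun F G => G ⋙ F)
    (fun _ _ ⟨a⟩ _ _ ⟨b⟩ => ⟨Functor.isoWhiskerLeft _ a ≪≫ Functor.isoWhiskerRight b _⟩)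
  mul_assoc := by rintro ⟨F⟩ ⟨G⟩ ⟨H⟩; rfl
  one_mul := by rintro ⟨F⟩; rfl
  mul_one := by rintro ⟨F⟩; rfl

variable (k : Type w) [Field k] (A : Type u) [Ring A] [Algebra k A]

/-- The monoid generated by the isomorphism classes of the projection functors attached to the
simple finite-dimensional `A`-modules. -/
def projMonoid : Submonoid (EndoClass (FDMod k A)) :=
  Submonoid.closure
    {c | ∃ S : FDMod k A, IsSimpleModule A S.obj ∧ c = EndoClass.mk (projFunctor k S)}

end Monoid

/-! ### The path algebra -/

section PathAlgebra

variable (k : Type w) [Field k] (Q : Type u) [Quiver.{v} Q]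

/-- All paths of `Q`; `⟨a, b, p⟩` is a path `p` from `a` to `b`. -/
abbrev PathIn := Σ a b : Q, Quiver.Path a b

/-- The path algebra: the `k`-vector space with basis the paths of `Q`. -/
def PathAlgebra := PathIn Q →₀ k

namespace PathAlgebra

noncomputable instance : AddCommGroup (PathAlgebra k Q) :=
  inferInstanceAs (AddCommGroup (PathIn Q →₀ k))

noncomputable instance : Module k (PathAlgebra k Q) :=
  inferInstanceAs (Module k (PathIn Q →₀ k))

variable {Q}

/-- The basis element of a path. -/
noncomputable def single (x : PathIn Q) : PathAlgebra k Q := Finsupp.single x (1 : k)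

open Classical in
/-- The product `q p` of two paths: first `p`, then `q`, and `0` if `p` does not end where
`q` starts. -/
noncomputable def pathMul (q p : PathIn Q) : PathAlgebra k Q :=
  if h : p.2.1 = q.1 then single k ⟨p.1, q.2.1, p.2.2.comp (q.2.2.cast h.symm rfl)⟩ else 0

variable (Q) in
/-- The bilinear extension of the product of paths. -/
noncomputable def mulLin : PathAlgebra k Q →ₗ[k] PathAlgebra k Q →ₗ[k] PathAlgebra k Q :=
  Finsupp.linearCombination k
    (fun q => (Finsupp.linearCombination k (pathMul k q) : (PathIn Q →₀ k) →ₗ[k] PathAlgebra k Q))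

noncomputable instance : Mul (PathAlgebra k Q) := ⟨fun x y => mulLin k Q x y⟩

/-- The unit is the sum of the trivial paths. -/
noncomputable instance [Fintype Q] : One (PathAlgebra k Q) :=
  ⟨∑ a : Q, single k ⟨a, a, Quiver.Path.nil⟩⟩

theorem mul_def (x y : PathAlgebra k Q) : x * y = mulLin k Q x y := rfl

theorem one_def [Fintype Q] : (1 : PathAlgebra k Q) = ∑ a : Q, single k ⟨a, a, Quiver.Path.nil⟩ :=
  rfl

theorem single_mul_single (q p : PathIn Q) : single k q * single k p = pathMul k q p := by
  have h : mulLin k Q (single k q) = Finsupp.linearCombination k (pathMul k q) :=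
    (Finsupp.linearCombination_single k _ _).trans (one_smul _ _)
  rw [mul_def, h]
  exact (Finsupp.linearCombination_single k _ _).trans (one_smul _ _)

theorem single_comp {a b c : Q} (p : Quiver.Path a b) (q : Quiver.Path b c) :
    single k ⟨b, c, q⟩ * single k ⟨a, b, p⟩ = single k ⟨a, c, p.comp q⟩ := by
  rw [single_mul_single]
  simp [pathMul]

theorem single_mul_of_ne {q p : PathIn Q} (h : p.2.1 ≠ q.1) : single k q * single k p = 0 := by
  rw [single_mul_single]
  simp [pathMul, h]

@[elab_as_elim]
theorem induction_on {P : PathAlgebra k Q → Prop} (x : PathAlgebra k Q) (h0 : P 0)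
    (hadd : ∀ x y, P x → P y → P (x + y)) (hs : ∀ (c : k) p, P (c • single k p)) : P x := by
  refine Finsupp.induction_linear x h0 hadd fun p c => ?_
  have : (Finsupp.single p c : PathIn Q →₀ k) = c • (Finsupp.single p (1 : k)) := by simp
  rw [this]
  exact hs c p

theorem smul_mul' (c : k) (x y : PathAlgebra k Q) : c • x * y = c • (x * y) := by
  simp [mul_def]

theorem mul_smul' (c : k) (x y : PathAlgebra k Q) : x * c • y = c • (x * y) := by
  simp [mul_def]

theorem add_mul' (x y z : PathAlgebra k Q) : (x + y) * z = x * z + y * z := by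
  simp [mul_def]

theorem mul_add' (x y z : PathAlgebra k Q) : x * (y + z) = x * y + x * z := by
  simp [mul_def]

theorem zero_mul' (x : PathAlgebra k Q) : 0 * x = 0 := by simp [mul_def]

theorem mul_zero' (x : PathAlgebra k Q) : x * 0 = 0 := by simp [mul_def]

theorem mul_assoc' (x y z : PathAlgebra k Q) : x * y * z = x * (y * z) := by
  induction x using induction_on with
  | h0 => simp only [zero_mul']
  | hadd x x' h h' => simp only [add_mul', h, h']
  | hs c p =>
  induction y using induction_on with
  | h0 => simp only [zero_mul', mul_zero']
  | hadd x x' h h' => simp only [add_mul', mul_add', h, h']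
  | hs c' q =>
  induction z using induction_on with
  | h0 => simp only [mul_zero']
  | hadd x x' h h' => simp only [mul_add', h, h']
  | hs c'' r =>
  simp only [smul_mul', mul_smul']
  congr 3
  obtain ⟨a, b, p⟩ := p
  obtain ⟨c, d, q⟩ := q
  obtain ⟨e, f, r⟩ := r
  by_cases h : d = a
  · subst h
    by_cases h' : f = c
    · subst h'
      simp only [single_comp, Quiver.Path.comp_assoc]
    · rw [single_comp, single_mul_of_ne k (q := ⟨c, d, q⟩) (p := ⟨e, f, r⟩) h',
        single_mul_of_ne k (p := ⟨e, f, r⟩) h', mul_zero']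
  · rw [single_mul_of_ne k (q := ⟨a, b, p⟩) (p := ⟨c, d, q⟩) h, zero_mul']
    by_cases h' : f = c
    · subst h'
      rw [single_comp, single_mul_of_ne k (q := ⟨a, b, p⟩) h]
    · rw [single_mul_of_ne k (q := ⟨c, d, q⟩) (p := ⟨e, f, r⟩) h', mul_zero']

variable [Fintype Q]

theorem one_mul' (x : PathAlgebra k Q) : 1 * x = x := by
  induction x using induction_on with
  | h0 => exact mul_zero' k 1
  | hadd x y h h' => rw [mul_add', h, h']
  | hs c p =>
  obtain ⟨a, b, p⟩ := p
  rw [mul_smul', one_def, mul_def, map_sum, LinearMap.sum_apply, Finset.sum_eq_single b]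
  · rw [← mul_def, single_comp, Quiver.Path.comp_nil]
  · intro d _ hd
    rw [← mul_def]
    exact single_mul_of_ne k (Ne.symm hd)
  · simp

theorem mul_one' (x : PathAlgebra k Q) : x * 1 = x := by
  induction x using induction_on with
  | h0 => exact zero_mul' k 1
  | hadd x y h h' => rw [add_mul', h, h']
  | hs c p =>
  obtain ⟨a, b, p⟩ := p
  rw [smul_mul', one_def, mul_def, map_sum, Finset.sum_eq_single a]
  · rw [← mul_def, single_comp, Quiver.Path.nil_comp]
  · intro d _ hd
    rw [← mul_def]
    exact single_mul_of_ne k hd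
  · simp

noncomputable instance : Ring (PathAlgebra k Q) where
  __ := (inferInstance : AddCommGroup (PathAlgebra k Q))
  left_distrib := mul_add' k
  right_distrib := add_mul' k
  zero_mul := zero_mul' k
  mul_zero := mul_zero' k
  mul_assoc := mul_assoc' k
  one_mul := one_mul' k
  mul_one := mul_one' k

noncomputable instance : Algebra k (PathAlgebra k Q) :=
  Algebra.ofModule (smul_mul' k) (mul_smul' k)

end PathAlgebra

end PathAlgebra

/-! ### The simple modules attached to the vertices -/

section Vertex

open scoped ModuleCat

variable (k : Type w) [Field k] {Q : Type u} [Quiver.{v} Q]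

/-- The coefficient of the trivial path at `t`. -/
noncomputable def coeffNil (t : Q) : PathAlgebra k Q →ₗ[k] k :=
  (Finsupp.lapply (⟨t, t, Quiver.Path.nil⟩ : PathIn Q) : (PathIn Q →₀ k) →ₗ[k] k)

open Classical in
theorem coeffNil_single (t : Q) (x : PathIn Q) :
    coeffNil k t (PathAlgebra.single k x) = if x = ⟨t, t, Quiver.Path.nil⟩ then 1 else 0 :=
  Finsupp.single_apply

theorem pathIn_comp_eq_nil_iff {t a b c : Q} (p : Quiver.Path a b) (q : Quiver.Path b c) :
    ((⟨a, c, p.comp q⟩ : PathIn Q) = ⟨t, t, Quiver.Path.nil⟩) ↔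
      ((⟨b, c, q⟩ : PathIn Q) = ⟨t, t, Quiver.Path.nil⟩ ∧
        (⟨a, b, p⟩ : PathIn Q) = ⟨t, t, Quiver.Path.nil⟩) := by
  constructor
  · intro h
    cases q with
    | nil =>
      rw [Quiver.Path.comp_nil] at h
      refine ⟨?_, h⟩
      cases h
      rfl
    | cons q e =>
      rw [Quiver.Path.comp_cons] at h
      cases h
  · rintro ⟨h, h'⟩
    cases h'
    cases h
    rfl

variable [Fintype Q]

/-- The algebra homomorphism `kQ → k` sending the trivial path at `t` to `1` and all other paths
to `0`. -/
noncomputable def vertexHom (t : Q) : PathAlgebra k Q →ₐ[k] k :=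
  AlgHom.ofLinearMap (coeffNil k t)
    (by
      classical
      rw [PathAlgebra.one_def, map_sum, Finset.sum_eq_single t]
      · simp [coeffNil_single]
      · intro b _ hb
        rw [coeffNil_single, if_neg]
        intro h
        exact hb (congrArg Sigma.fst h)
      · simp)
    (by
      classical
      intro x y
      induction x using PathAlgebra.induction_on with
      | h0 => simp
      | hadd x x' h h' => simp only [add_mul, map_add, h, h']
      | hs c p =>
      induction y using PathAlgebra.induction_on with
      | h0 => simp
      | hadd x x' h h' => simp only [mul_add, map_add, h, h']
      | hs c' q =>
      rw [smul_mul_smul_comm]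
      simp only [map_smul, smul_eq_mul]
      suffices h : coeffNil k t (PathAlgebra.single k p * PathAlgebra.single k q) =
          coeffNil k t (PathAlgebra.single k p) * coeffNil k t (PathAlgebra.single k q) by
        rw [h]; ring
      obtain ⟨a, b, p⟩ := p
      obtain ⟨c, d, q⟩ := q
      by_cases h : d = a
      · subst h
        rw [PathAlgebra.single_comp]
        simp only [coeffNil_single, pathIn_comp_eq_nil_iff]
        split_ifs <;> simp_all
      · rw [PathAlgebra.single_mul_of_ne k (q := ⟨a, b, p⟩) (p := ⟨c, d, q⟩) h, map_zero]
        simp only [coeffNil_single]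
        split_ifs with h1 h2
        · cases h1
          cases h2
          exact absurd rfl h
        all_goals simp)

/-- The one-dimensional module `S_t`: the trivial path at `t` acts as the identity, all other paths
act as `0`. -/
@[nolint unusedArguments]
def VertexModule (k : Type w) [Field k] {Q : Type u} (_t : Q) : Type w := k

noncomputable instance (t : Q) : AddCommGroup (VertexModule k t) := inferInstanceAs (AddCommGroup k)

noncomputable instance (t : Q) : Module (PathAlgebra k Q) (VertexModule k t) :=
  Module.compHom k (vertexHom k t).toRingHom

/-- The identity, as an additive equivalence between `S_t` and `k`. -/
noncomputable def vertexEquiv {k : Type w} [Field k] {Q : Type u} (t : Q) :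
    VertexModule k t ≃+ k := AddEquiv.refl k

theorem vertexEquiv_smul (t : Q) (x : PathAlgebra k Q) (c : VertexModule k t) :
    vertexEquiv t (x • c) = vertexHom k t x * vertexEquiv t c := rfl

theorem vertexModule_cyclic (t : Q) {c : VertexModule k t} (hc : c ≠ 0) (d : VertexModule k t) :
    ∃ a : k, algebraMap k (PathAlgebra k Q) a • c = d := by
  refine ⟨vertexEquiv t d * (vertexEquiv t c)⁻¹, (vertexEquiv t).injective ?_⟩
  rw [vertexEquiv_smul, AlgHom.commutes]
  exact inv_mul_cancel_right₀ ((vertexEquiv t).map_ne_zero_iff.2 hc) _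

instance (t : Q) : Nontrivial (VertexModule k t) := inferInstanceAs (Nontrivial k)

instance (t : Q) : IsSimpleModule (PathAlgebra k Q) (VertexModule k t) := by
  rw [isSimpleModule_iff_toSpanSingleton_surjective]
  refine ⟨inferInstance, fun c hc d => ?_⟩
  obtain ⟨a, ha⟩ := vertexModule_cyclic k t hc d
  exact ⟨_, ha⟩

theorem finiteDimensional_of_cyclic {A : Type u} [Ring A] [Algebra k A] (M : ModuleCat.{w} A)
    (x : M) (h : ∀ y : M, ∃ c : k, algebraMap k A c • x = y) : FiniteDimensional k M :=
  Module.Finite.of_surjective (LinearMap.toSpanSingleton k M x) h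

/-- `S_t` as an object of the category of finite-dimensional `kQ`-modules. -/
noncomputable def simpleAt (t : Q) : FDMod k (PathAlgebra k Q) :=
  ⟨ModuleCat.of (PathAlgebra k Q) (VertexModule k t),
    finiteDimensional_of_cyclic k _ _
      (vertexModule_cyclic k t (exists_ne (0 : VertexModule k t)).choose_spec)⟩

/-- The projection functor attached to the vertex `t`. -/
noncomputable def vertexFunctor (t : Q) : FDMod k (PathAlgebra k Q) ⥤ FDMod k (PathAlgebra k Q) :=
  projFunctor k (simpleAt k t)

/-- The class of the projection functor attached to the vertex `t`, in the monoid generated by all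
projection functors attached to simple `kQ`-modules. -/
noncomputable def vertexClass (t : Q) : projMonoid k (PathAlgebra k Q) :=
  ⟨EndoClass.mk (vertexFunctor k t), Submonoid.subset_closure
    ⟨simpleAt k t, inferInstanceAs (IsSimpleModule (PathAlgebra k Q) (VertexModule k t)), rfl⟩⟩

/-- The functor attached to a word: `t₁ t₂ ⋯ tᵣ` is sent to the composite of the functors attached
to `t₁, …, tᵣ`, where the one attached to `tᵣ` acts first. -/
noncomputable def wordFunctor : List Q → (FDMod k (PathAlgebra k Q) ⥤ FDMod k (PathAlgebra k Q))
  | [] => 𝟭 _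
  | t :: w => wordFunctor w ⋙ vertexFunctor k t

end Vertex

/-! ### The relations, the algebra `B_Q` and admissible normal forms -/

section Relations

variable (k : Type w) [Field k] (Q : Type u) [Quiver.{v} Q]

/-- The defining relations between words over the vertices. -/
inductive WordRel : FreeMonoid Q → FreeMonoid Q → Prop
  | idem (s : Q) : WordRel (.of s * .of s) (.of s)
  | braid (s t : Q) : WordRel (.of s * .of t * .of s) (.of t * .of s * .of t)
  | kiselman (s t : Q) (h : IsEmpty (t ⟶ s)) : WordRel (.of t * .of s * .of t) (.of s * .of t)

/-- The same relations, between elements of the free algebra over the vertices. -/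
inductive AlgRel : FreeAlgebra k Q → FreeAlgebra k Q → Prop
  | idem (s : Q) : AlgRel (.ι k s * .ι k s) (.ι k s)
  | braid (s t : Q) : AlgRel (.ι k s * .ι k t * .ι k s) (.ι k t * .ι k s * .ι k t)
  | kiselman (s t : Q) (h : IsEmpty (t ⟶ s)) :
      AlgRel (.ι k t * .ι k s * .ι k t) (.ι k s * .ι k t)

/-- The algebra `B_Q`, given by generators and relations. -/
abbrev BAlgebra := RingQuot (AlgRel k Q)

variable {Q}

/-- The generator `X_t` of `B_Q`. -/
noncomputable def gen (t : Q) : BAlgebra k Q := RingQuot.mkAlgHom k (AlgRel k Q) (FreeAlgebra.ι k t)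

/-- The monomial `X_w` of `B_Q` attached to a word `w`. -/
noncomputable def monomial (w : FreeMonoid Q) : BAlgebra k Q := FreeMonoid.lift (gen k) w

/-- Admissible normal forms associated with `Q` (over the field `k`). -/
structure IsAdmissibleNormalForm [Fintype Q] (W : Set (FreeMonoid Q)) : Prop where
  one_mem : 1 ∈ W
  of_mem : ∀ t : Q, FreeMonoid.of t ∈ W
  mul_gen : ∀ w ∈ W, ∀ t : Q, ∃ w' ∈ W, monomial k w * gen k t = monomial k w'
  separated : ∀ v ∈ W, ∀ w ∈ W, v ≠ w → ∃ V : FDMod k (PathAlgebra k Q),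
    IsEmpty ((wordFunctor k v.toList).obj V ≅ (wordFunctor k w.toList).obj V)

end Relations

/-! ### Admissible tree quivers -/

section Tree

variable (Q : Type u) [Quiver.{v} Q]

/-- The underlying graph of `Q` is a tree. In particular there are no loops, and at most one arrow
between any two vertices. -/
structure IsTreeQuiver : Prop where
  isTree : (SimpleGraph.fromRel fun a b : Q => Nonempty (a ⟶ b)).IsTree
  subsingleton : ∀ a b : Q, Subsingleton (a ⟶ b)
  isEmpty_symm : ∀ a b : Q, Nonempty (a ⟶ b) → IsEmpty (b ⟶ a)

variable {Q}

/-- No arrow starts at `t`. -/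
def IsSink (t : Q) : Prop := ∀ a, IsEmpty (t ⟶ a)

/-- No arrow ends at `t`. -/
def IsSource (t : Q) : Prop := ∀ a, IsEmpty (a ⟶ t)

/-- The entry degree or the exit degree of `t` is at least two. -/
def IsCrossing (t : Q) : Prop :=
  2 ≤ ENat.card (Quiver.Costar t) ∨ 2 ≤ ENat.card (Quiver.Star t)

variable (Q) in
/-- Tree quivers in which every crossing is a sink or a source. -/
structure IsAdmissibleTreeQuiver : Prop extends IsTreeQuiver Q where
  sink_or_source : ∀ t : Q, IsCrossing t → IsSink t ∨ IsSource t

end Tree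

end ProjFun

open ProjFun

/-!
Each word `w` over the vertices gives a functor `F_w` together with a projection from the identity
functor onto it. The kernel of `M → F_w M` is computed letter by letter: prefixing `t` leaves the
components at the other vertices unchanged, and replaces the component at `t` by the set of elements
that all arrows starting at `t` move into the old kernel (`mem_wordKer_cons_of_ne`,
`mem_wordKer_cons_self`). Quotient functors of the identity with equal kernels are isomorphic, so
the defining relations can be verified on kernels (`wordKer_idem`, `wordKer_braid`,
`wordKer_kiselman`). Every simple module is some `S_t`, so that the presented monoid maps onto the
monoid of projection functors.

For injectivity, evaluate `F_w` at modules `V_q` that are, up to simple direct summands, the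
injective hulls of the simple modules `S_q`. All components being at most one-dimensional, the
isomorphism classes of the modules `F_w V_q` amount to the combinatorial datum
`state w : Q → Set Q` (`state_eq_of_iso`). It remains to see that the state of `w` determines the
class of `w` in the presented monoid. It is enough to consider words of minimal length in their
class. In such a word, between two occurrences of `t` there is an out-neighbour and an in-neighbour
of `t`. Hence `t` is neither a sink nor a source, and admissibility makes both neighbours unique.
Consequently every application of a letter changes the state (`IsShort.state_ne`). If `t` is the
first letter of a short word, then every other short word with the same state can be brought by
commutations into a form with first letter `t` (`not_adj_of_state_eq`), and the states before that
last application of `t` agree again (`state_eq_of_cons`), because the unique in-neighbour of `t`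
has recorded the former state of `t`. Induction on the length finishes the argument
(`IsShort.wordClass_eq`).

A normal form is then any system of representatives for the classes of words that contains the words
of length at most one, and `B_Q` is the monoid algebra of the presented monoid for formal reasons.
-/

namespace ProjFun

/-! ### Directed paths in a tree quiver -/

section TreePaths

variable {Q : Type u} [Quiver.{v} Q]

theorem IsTreeQuiver.adj (hQ : IsTreeQuiver Q) {a b : Q} (e : a ⟶ b) :
    (SimpleGraph.fromRel fun a b : Q => Nonempty (a ⟶ b)).Adj a b := by
  rw [SimpleGraph.fromRel_adj]
  refine ⟨?_, Or.inl ⟨e⟩⟩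
  rintro rfl
  exact (hQ.isEmpty_symm a a ⟨e⟩).false e

/-- The walk in the underlying graph that follows a directed path. -/
def IsTreeQuiver.walk (hQ : IsTreeQuiver Q) {a : Q} : {b : Q} → Quiver.Path a b →
    (SimpleGraph.fromRel fun a b : Q => Nonempty (a ⟶ b)).Walk a b
  | _, .nil => .nil
  | _, .cons p e => (hQ.walk p).concat (hQ.adj e)

theorem IsTreeQuiver.walk_toPath_comp (hQ : IsTreeQuiver Q) {a b c : Q} (e : a ⟶ b)
    (p : Quiver.Path b c) : hQ.walk (e.toPath.comp p) = .cons (hQ.adj e) (hQ.walk p) := by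
  induction p with
  | nil => rfl
  | cons p f ih =>
    rw [Quiver.Path.comp_cons, walk, ih, walk, SimpleGraph.Walk.concat_cons]

/-- A walk in a tree that returns to an earlier vertex has to turn back along an edge, which a
directed path cannot do. -/
theorem IsTreeQuiver.isPath_walk (hQ : IsTreeQuiver Q) {a b : Q} (p : Quiver.Path a b) :
    (hQ.walk p).IsPath := by
  induction p with
  | nil => exact SimpleGraph.Walk.IsPath.nil
  | @cons b c p e ih =>
    refine ih.concat (fun hc => ?_) _
    have h := hQ.isTree.isAcyclic.eq_penultimate_of_adj_end ih (hQ.adj e) hc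
    cases p with
    | nil =>
      rw [walk, SimpleGraph.Walk.penultimate_nil] at h
      exact (hQ.adj e).ne h.symm
    | cons p f =>
      rw [walk, SimpleGraph.Walk.penultimate_concat] at h
      subst h
      exact (hQ.isEmpty_symm _ _ ⟨e⟩).false f

/-- A tree quiver has no oriented cycles. -/
theorem IsTreeQuiver.isEmpty_path (hQ : IsTreeQuiver Q) {a b : Q} (e : a ⟶ b) :
    IsEmpty (Quiver.Path b a) := by
  refine ⟨fun p => ?_⟩
  have h := hQ.isPath_walk (e.toPath.comp p)
  rw [SimpleGraph.Walk.isPath_iff_nil, walk_toPath_comp] at h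
  cases h

/-- The out-neighbours of a vertex of a tree quiver reach disjoint sets of vertices. -/
theorem IsTreeQuiver.eq_of_path (hQ : IsTreeQuiver Q) {a b b' c : Q} (e : a ⟶ b) (e' : a ⟶ b')
    (p : Quiver.Path b c) (p' : Quiver.Path b' c) : b = b' := by
  have h := Subtype.mk.inj ((hQ.isTree.isAcyclic.subsingleton_path a c).elim
    ⟨_, hQ.isPath_walk (e.toPath.comp p)⟩ ⟨_, hQ.isPath_walk (e'.toPath.comp p')⟩)
  rw [walk_toPath_comp, walk_toPath_comp] at h
  injection h

/-- A vertex with an entering and a leaving arrow is no crossing. -/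
theorem IsAdmissibleTreeQuiver.not_isCrossing (hQ : IsAdmissibleTreeQuiver Q) {a t b : Q}
    (e : a ⟶ t) (f : t ⟶ b) : ¬ IsCrossing t := fun h =>
  (hQ.sink_or_source t h).elim (fun h => (h b).false f) (fun h => (h a).false e)

theorem IsAdmissibleTreeQuiver.eq_of_in (hQ : IsAdmissibleTreeQuiver Q) {a a' t b : Q}
    (e : a ⟶ t) (e' : a' ⟶ t) (f : t ⟶ b) : a = a' := by
  by_contra h
  refine hQ.not_isCrossing e f (Or.inl ?_)
  have : Nontrivial (Quiver.Costar t) := ⟨⟨a, e⟩, ⟨a', e'⟩, fun h' => h (congrArg Sigma.fst h')⟩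
  exact Order.add_one_le_of_lt ENat.one_lt_card

theorem IsAdmissibleTreeQuiver.eq_of_out (hQ : IsAdmissibleTreeQuiver Q) {a t b b' : Q}
    (e : a ⟶ t) (f : t ⟶ b) (f' : t ⟶ b') : b = b' := by
  by_contra h
  refine hQ.not_isCrossing e f (Or.inr ?_)
  have : Nontrivial (Quiver.Star t) := ⟨⟨b, f⟩, ⟨b', f'⟩, fun h' => h (congrArg Sigma.fst h')⟩
  exact Order.add_one_le_of_lt ENat.one_lt_card

end TreePaths

/-! ### Short words in the presented monoid -/

section ShortWords

variable {Q : Type u} [Quiver.{v} Q]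

/-- The class of a word in the monoid given by the defining relations. -/
def wordClass (w : List Q) : PresentedMonoid (WordRel Q) :=
  PresentedMonoid.mk (WordRel Q) (FreeMonoid.ofList w)

@[simp]
theorem wordClass_nil : wordClass ([] : List Q) = 1 := rfl

@[simp]
theorem wordClass_append (a b : List Q) : wordClass (a ++ b) = wordClass a * wordClass b := rfl

theorem wordClass_cons (t : Q) (w : List Q) :
    wordClass (t :: w) = PresentedMonoid.of (WordRel Q) t * wordClass w := rfl

@[simp]
theorem wordClass_singleton (t : Q) : wordClass [t] = PresentedMonoid.of (WordRel Q) t := rfl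

theorem of_mul_self (s : Q) : PresentedMonoid.of (WordRel Q) s * .of _ s = .of _ s :=
  PresentedMonoid.mk_eq_mk_of_rel (WordRel.idem s)

theorem of_braid (s t : Q) : PresentedMonoid.of (WordRel Q) s * .of _ t * .of _ s =
    .of _ t * .of _ s * .of _ t :=
  PresentedMonoid.mk_eq_mk_of_rel (WordRel.braid s t)

theorem of_kiselman (s t : Q) (h : IsEmpty (t ⟶ s)) :
    PresentedMonoid.of (WordRel Q) t * .of _ s * .of _ t = .of _ s * .of _ t :=
  PresentedMonoid.mk_eq_mk_of_rel (WordRel.kiselman s t h)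

theorem of_mul_comm (s t : Q) (h : IsEmpty (t ⟶ s)) (h' : IsEmpty (s ⟶ t)) :
    PresentedMonoid.of (WordRel Q) s * .of _ t = .of _ t * .of _ s :=
  (of_kiselman s t h).symm.trans ((of_braid t s).trans (of_kiselman t s h'))

theorem of_mul_wordClass_comm (t : Q) (a : List Q)
    (h : ∀ s ∈ a, IsEmpty (t ⟶ s) ∧ IsEmpty (s ⟶ t)) :
    wordClass a * .of _ t = PresentedMonoid.of (WordRel Q) t * wordClass a := by
  induction a with
  | nil => simp
  | cons s a ih =>
    rw [wordClass_cons, mul_assoc, ih fun r hr => h r (List.mem_cons_of_mem _ hr), ← mul_assoc,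
      of_mul_comm s t (h s List.mem_cons_self).1 (h s List.mem_cons_self).2, mul_assoc]

/-- If `a` contains no out-neighbour of `t`, then the second (left) application of `t` is
superfluous. -/
theorem of_mul_wordClass_mul_of_out (t : Q) (a : List Q) (h : ∀ s ∈ a, IsEmpty (t ⟶ s)) :
    .of _ t * wordClass a * .of _ t = wordClass a * PresentedMonoid.of (WordRel Q) t := by
  induction a using List.reverseRecOn with
  | nil => simpa using of_mul_self t
  | append_singleton a s ih =>
    have ih := ih fun r hr => h r (by simp [hr])
    have hs := of_kiselman s t (h s (by simp))
    calc _ = .of _ t * wordClass a * (.of _ s * .of _ t) := by simp [mul_assoc]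
      _ = .of _ t * wordClass a * (.of _ t * .of _ s * .of _ t) := by rw [hs]
      _ = (.of _ t * wordClass a * .of _ t) * (.of _ s * .of _ t) := by simp only [mul_assoc]
      _ = wordClass a * (.of _ t * .of _ s * .of _ t) := by rw [ih]; simp only [mul_assoc]
      _ = _ := by rw [hs]; simp [mul_assoc]

/-- If `a` contains no in-neighbour of `t`, then the first (right) application of `t` is
superfluous. -/
theorem of_mul_wordClass_mul_of_in (t : Q) (a : List Q) (h : ∀ s ∈ a, IsEmpty (s ⟶ t)) :
    .of _ t * wordClass a * .of _ t = PresentedMonoid.of (WordRel Q) t * wordClass a := by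
  induction a with
  | nil => simpa using of_mul_self t
  | cons s a ih =>
    have ih := ih fun r hr => h r (by simp [hr])
    have hs : PresentedMonoid.of (WordRel Q) t * .of _ s * .of _ t = .of _ t * .of _ s := by
      rw [of_braid, of_kiselman t s (h s (by simp))]
    calc _ = (.of _ t * .of _ s) * wordClass a * .of _ t := by simp [wordClass_cons, mul_assoc]
      _ = (.of _ t * .of _ s * .of _ t) * wordClass a * .of _ t := by rw [hs]
      _ = .of _ t * .of _ s * (.of _ t * wordClass a * .of _ t) := by simp only [mul_assoc]
      _ = (.of _ t * .of _ s * .of _ t) * wordClass a := by rw [ih]; simp only [mul_assoc]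
      _ = _ := by rw [hs]; simp [wordClass_cons, mul_assoc]

/-- A word is short if it has minimal length among the words representing its class. -/
def IsShort (w : List Q) : Prop := ∀ w', wordClass w' = wordClass w → w.length ≤ w'.length

theorem exists_isShort (w : List Q) : ∃ w', IsShort w' ∧ wordClass w' = wordClass w := by
  obtain ⟨w', h, hmin⟩ := exists_minimalFor_of_wellFoundedLT
    (fun w' => wordClass w' = wordClass w) List.length ⟨w, rfl⟩
  refine ⟨w', fun x hx => ?_, h⟩
  by_contra hlt
  exact hlt (hmin (hx.trans h) (by omega))

theorem IsShort.congr {w w' : List Q} (h : IsShort w) (hc : wordClass w' = wordClass w)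
    (hl : w'.length = w.length) : IsShort w' := fun x hx => hl ▸ h x (hx.trans hc)

theorem IsShort.infix {a b c : List Q} (h : IsShort (a ++ b ++ c)) : IsShort b := by
  intro x hx
  have := h (a ++ x ++ c) (by simp [hx])
  simp only [List.length_append] at this
  omega

theorem IsShort.right {a b : List Q} (h : IsShort (a ++ b)) : IsShort b :=
  IsShort.infix (a := a) (c := []) (by simpa using h)

theorem IsShort.tail {t : Q} {b : List Q} (h : IsShort (t :: b)) : IsShort b :=
  IsShort.right (a := [t]) h

/-- Between two occurrences of `t` in a short word there is an out-neighbour of `t`. -/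
theorem IsShort.exists_out {t : Q} {a b : List Q} (h : IsShort (t :: (a ++ t :: b))) :
    ∃ s ∈ a, Nonempty (t ⟶ s) := by
  by_contra! hno
  have h1 : IsShort ([t] ++ a ++ [t]) :=
    IsShort.infix (a := []) (c := b) (by simpa using h)
  have := h1 (a ++ [t]) (by
    simpa [wordClass_cons, mul_assoc] using (of_mul_wordClass_mul_of_out t a hno).symm)
  simp at this

/-- Between two occurrences of `t` in a short word there is an in-neighbour of `t`. -/
theorem IsShort.exists_in {t : Q} {a b : List Q} (h : IsShort (t :: (a ++ t :: b))) :
    ∃ s ∈ a, Nonempty (s ⟶ t) := by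
  by_contra! hno
  have h1 : IsShort ([t] ++ a ++ [t]) :=
    IsShort.infix (a := []) (c := b) (by simpa using h)
  have := h1 ([t] ++ a) (by
    simpa [wordClass_cons, mul_assoc] using (of_mul_wordClass_mul_of_in t a hno).symm)
  simp at this

end ShortWords

/-! ### The combinatorial state of a word -/

section State

variable {Q : Type u} [Quiver.{v} Q]

open Classical in
/-- The set of those `q` for which the functor attached to the word does not annihilate the
component at `t` of the injective hull of the simple module at `q` (see `mem_state_iff`), computed
letter by letter: in the beginning these are the vertices that can be reached from `t`, and applying
the letter `t` replaces the set at `t` by the union of the sets at the out-neighbours of `t`. -/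
def state : List Q → Q → Set Q
  | [], t => {q | Nonempty (Quiver.Path t q)}
  | s :: w, t => if t = s then {q | ∃ r, Nonempty (t ⟶ r) ∧ q ∈ state w r} else state w t

theorem mem_state_cons_self {t q : Q} {w : List Q} :
    q ∈ state (t :: w) t ↔ ∃ r, Nonempty (t ⟶ r) ∧ q ∈ state w r := by
  simp [state]

theorem state_cons_of_ne {s t : Q} (h : t ≠ s) (w : List Q) : state (s :: w) t = state w t := by
  simp [state, h]

theorem state_append_of_notMem {t : Q} {a : List Q} (h : t ∉ a) (b : List Q) :
    state (a ++ b) t = state b t := by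
  induction a with
  | nil => rfl
  | cons s a ih =>
    rw [List.mem_cons, not_or] at h
    rw [List.cons_append, state_cons_of_ne h.1, ih h.2]

theorem state_of_notMem {t : Q} {a : List Q} (h : t ∉ a) : state a t = state [] t := by
  simpa using state_append_of_notMem h []

/-- The state of a vertex contains the states of its out-neighbours; hence states can only decrease
(`state_append_subset`). -/
theorem state_subset_of_arrow (w : List Q) {t r : Q} (e : t ⟶ r) : state w r ⊆ state w t := by
  induction w generalizing t r with
  | nil => exact fun q ⟨p⟩ => ⟨e.toPath.comp p⟩
  | cons s w ih =>
    intro q hq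
    by_cases ht : t = s
    · subst ht
      by_cases hr : r = t
      · rwa [hr] at hq
      · rw [state_cons_of_ne hr] at hq
        exact mem_state_cons_self.2 ⟨r, ⟨e⟩, hq⟩
    · rw [state_cons_of_ne ht]
      by_cases hr : r = s
      · subst hr
        obtain ⟨r', ⟨e'⟩, hq⟩ := mem_state_cons_self.1 hq
        exact ih e (ih e' hq)
      · rw [state_cons_of_ne hr] at hq
        exact ih e hq

theorem state_append_subset (a b : List Q) (t : Q) : state (a ++ b) t ⊆ state b t := by
  induction a with
  | nil => rfl
  | cons s a ih =>
    by_cases h : t = s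
    · subst h
      intro q hq
      obtain ⟨r, ⟨e⟩, hq⟩ := mem_state_cons_self.1 hq
      exact ih (state_subset_of_arrow _ e hq)
    · rwa [List.cons_append, state_cons_of_ne h]

theorem state_append_cons_of_ne {t : Q} {a : List Q} (ha : ∀ s ∈ a, IsEmpty (s ⟶ t))
    (b : List Q) {x : Q} (hx : x ≠ t) : state (a ++ t :: b) x = state (a ++ b) x := by
  induction a generalizing x with
  | nil => exact state_cons_of_ne hx b
  | cons s a ih =>
    have ih := @ih fun r hr => ha r (List.mem_cons_of_mem _ hr)
    by_cases hxs : x = s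
    · subst hxs
      ext q
      rw [List.cons_append, mem_state_cons_self, List.cons_append, mem_state_cons_self]
      refine exists_congr fun r => and_congr_right fun ⟨f⟩ => ?_
      rw [ih]
      rintro rfl
      exact (ha x List.mem_cons_self).false f
    · rw [List.cons_append, state_cons_of_ne hxs, List.cons_append, state_cons_of_ne hxs, ih hx]

theorem path_of_mem_state {w : List Q} {t q : Q} (h : q ∈ state w t) :
    Nonempty (Quiver.Path t q) :=
  state_append_subset w [] t (by simpa using h)

/-- The state of a word determines which letters occur in it. -/
theorem mem_iff_notMem_state (hQ : IsTreeQuiver Q) {w : List Q} {t : Q} :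
    t ∈ w ↔ t ∉ state w t := by
  constructor
  · intro h h'
    obtain ⟨a, b, rfl⟩ := List.append_of_mem h
    obtain ⟨r, ⟨e⟩, hr⟩ := mem_state_cons_self.1 (state_append_subset a _ t h')
    obtain ⟨p⟩ := path_of_mem_state hr
    exact (hQ.isEmpty_path e).false p
  · intro h
    by_contra hn
    rw [state_of_notMem hn] at h
    exact h ⟨.nil⟩

/-- The part of the state at `s` that belongs to the out-neighbour `t` is the state of `t` at the
moment of the last application of `s`. -/
theorem state_cons_inter (hQ : IsTreeQuiver Q) {s t : Q} (e : s ⟶ t) (w : List Q) :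
    state (s :: w) s ∩ state [] t = state w t := by
  ext q
  constructor
  · rintro ⟨h, ⟨p⟩⟩
    obtain ⟨r, ⟨f⟩, hr⟩ := mem_state_cons_self.1 h
    obtain ⟨p'⟩ := path_of_mem_state hr
    rwa [hQ.eq_of_path e f p p']
  · intro h
    exact ⟨mem_state_cons_self.2 ⟨t, ⟨e⟩, h⟩, path_of_mem_state h⟩

theorem exists_eq_append_cons_notMem {α : Type*} {t : α} {w : List α} (h : t ∈ w) :
    ∃ a b, w = a ++ t :: b ∧ t ∉ b := by
  obtain ⟨a, b, h1, h2⟩ := List.eq_append_cons_of_mem (List.mem_reverse.2 h)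
  refine ⟨b.reverse, a.reverse, ?_, by simpa using h2⟩
  rw [← List.reverse_inj, h1]
  simp

/-- In a short word, every application of a letter changes the state. -/
theorem IsShort.state_ne (hQ : IsAdmissibleTreeQuiver Q) {a b : List Q} {s : Q}
    (h : IsShort (a ++ b)) (hs : s ∈ a) : state (a ++ b) s ≠ state b s := by
  induction hn : (a ++ b).length using Nat.strong_induction_on generalizing a b s with
  | _ n ih =>
  subst hn
  -- If `s` occurs in `b` too, then an out-neighbour of `s` occurs between two applications of `s`,
  -- and by induction its state has changed there.
  by_cases hsb : s ∈ b
  · obtain ⟨a₁, a₂, rfl, ha₂⟩ := exists_eq_append_cons_notMem hs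
    obtain ⟨b₁, b₂, rfl, hb₁⟩ := List.eq_append_cons_of_mem hsb
    have h1 : IsShort (s :: ((a₂ ++ b₁) ++ s :: b₂)) :=
      IsShort.right (a := a₁) (by simpa using h)
    obtain ⟨r, hr, ⟨f⟩⟩ := h1.exists_out
    obtain ⟨r', -, ⟨e⟩⟩ := h1.exists_in
    -- `s` has an entering and a leaving arrow, hence only one out-neighbour `r`, and an application
    -- of `s` copies the state of `r`.
    have key : ∀ x : List Q, state (s :: x) s = state x r := by
      intro x
      ext q
      rw [mem_state_cons_self]
      constructor
      · rintro ⟨r₁, ⟨f₁⟩, hq⟩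
        rwa [hQ.eq_of_out e f f₁]
      · exact fun hq => ⟨r, ⟨f⟩, hq⟩
    have h2 : state ((a₂ ++ b₁ ++ [s]) ++ b₂) r ≠ state b₂ r := by
      refine ih _ ?_ ?_ ?_ rfl
      · simp; omega
      · simpa using h1.tail
      · simp only [List.mem_append] at hr ⊢; tauto
    intro heq
    apply h2
    refine (state_append_subset _ _ _).antisymm ?_
    have h3 := state_append_subset a₁ (s :: (a₂ ++ b₁ ++ s :: b₂)) s
    rw [← key b₂, ← state_append_of_notMem hb₁ (s :: b₂), ← heq]
    rw [key] at h3
    simpa using h3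
  · intro heq
    have h1 := (mem_iff_notMem_state hQ.toIsTreeQuiver (w := a ++ b)).1 (List.mem_append_left b hs)
    rw [heq] at h1
    exact hsb ((mem_iff_notMem_state hQ.toIsTreeQuiver).2 h1)

/-- If `t` is the last letter applied in a short word, and `s` is its only in-neighbour, then the
state at `t` before that application can be read off at `s`. -/
theorem IsShort.state_inter (hQ : IsAdmissibleTreeQuiver Q) {w : List Q} {s t : Q}
    (h : IsShort (t :: w)) (e : s ⟶ t) (huniq : ∀ s', (s' ⟶ t) → s' = s) (hs : s ∈ w) :
    state w s ∩ state [] t = state w t := by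
  obtain ⟨a, b, rfl, ha⟩ := List.eq_append_cons_of_mem hs
  -- Otherwise `s` would occur in `a`, between two occurrences of `t`.
  have hta : t ∉ a := by
    intro hta
    obtain ⟨c, d, rfl, -⟩ := List.eq_append_cons_of_mem hta
    obtain ⟨s', hs', ⟨e'⟩⟩ := IsShort.exists_in (t := t) (a := c) (b := d ++ s :: b)
      (by simpa using h)
    rw [huniq s' e'] at hs'
    exact ha (by simp [hs'])
  have hts : t ≠ s := (hQ.toIsTreeQuiver.adj e).ne'
  rw [state_append_of_notMem ha, state_append_of_notMem hta, state_cons_of_ne hts,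
    state_cons_inter hQ.toIsTreeQuiver e]

/-- If a short word beginning with `t` has the same state as the short word `a ++ t :: b`, then no
letter of `a` is a neighbour of `t`, so that `t` can be moved to the front. An out-neighbour in `a`
would have changed its state after the last application of `t`; an in-neighbour `s` in `a` would
record the final state of `t`, whereas in the other word it records an earlier one. -/
theorem not_adj_of_state_eq (hQ : IsAdmissibleTreeQuiver Q) {w a b : List Q} {t : Q}
    (hv : IsShort (t :: w)) (hw : IsShort (a ++ t :: b)) (hta : t ∉ a)
    (hst : state (t :: w) = state (a ++ t :: b)) :
    ∀ s ∈ a, IsEmpty (t ⟶ s) ∧ IsEmpty (s ⟶ t) := by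
  have hT := hQ.toIsTreeQuiver
  intro s hs
  constructor
  · refine ⟨fun e => ?_⟩
    have hst' : s ≠ t := (hT.adj e).ne'
    refine IsShort.state_ne hQ (a := a ++ [t]) (b := b) (s := s) (by simpa using hw)
      (by simp [hs]) ?_
    rw [← state_cons_inter hT e b, ← state_append_of_notMem hta (t :: b), ← hst,
      state_cons_inter hT e w, ← state_cons_of_ne hst' w, hst]
    simp
  · refine ⟨fun e => ?_⟩
    have hts : t ≠ s := (hT.adj e).ne'
    obtain ⟨a₁, a₂, rfl, ha₁⟩ := List.eq_append_cons_of_mem hs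
    have hta₂ : t ∉ a₂ := fun h => hta (by simp [h])
    -- In `a ++ t :: b` the letter `s` is applied after `t`, in `t :: w` it is applied before.
    have h1 : state (t :: w) s ∩ state [] t = state (t :: w) t := by
      rw [hst, List.append_assoc, List.cons_append, state_append_of_notMem ha₁,
        state_cons_inter hT e, state_append_of_notMem hta₂, ← List.cons_append, ← List.append_assoc,
        state_append_of_notMem hta]
    have hsw : s ∈ w := by
      have : s ∈ t :: w := by
        rw [mem_iff_notMem_state hT, hst, ← mem_iff_notMem_state hT]
        simp
      exact (List.mem_cons.1 this).resolve_left hts.symm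
    obtain ⟨c, d, rfl, hc⟩ := List.eq_append_cons_of_mem hsw
    rw [state_cons_of_ne hts.symm, state_append_of_notMem hc, state_cons_inter hT e] at h1
    refine IsShort.state_ne hQ (a := t :: (c ++ [s])) (b := d) (s := t) (by simpa using hv)
      (by simp) ?_
    rw [h1]
    simp

/-- In short words, the state before the last application of `t` is determined by the state after
it. -/
theorem state_eq_of_cons (hQ : IsAdmissibleTreeQuiver Q) {v w : List Q} {t : Q}
    (hv : IsShort (t :: v)) (hw : IsShort (t :: w)) (h : state (t :: v) = state (t :: w)) :
    state v = state w := by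
  have hT := hQ.toIsTreeQuiver
  funext x
  by_cases hx : x = t
  · subst hx
    by_cases hocc : x ∈ v ∨ x ∈ w
    · -- `x` occurs twice in a short word, hence has exactly one in-neighbour, which occurs too.
      have : ∃ s : Q, Nonempty (s ⟶ x) ∧ (∀ s', (s' ⟶ x) → s' = s) ∧ s ∈ v ∧ s ∈ w := by
        have aux : ∀ {v w : List Q}, IsShort (x :: v) → state (x :: v) = state (x :: w) → x ∈ v →
            ∃ s : Q, Nonempty (s ⟶ x) ∧ (∀ s', (s' ⟶ x) → s' = s) ∧ s ∈ v ∧ s ∈ w := by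
          intro v w hv h hxv
          obtain ⟨a, b, rfl, -⟩ := List.eq_append_cons_of_mem hxv
          obtain ⟨r, -, ⟨f⟩⟩ := hv.exists_out
          obtain ⟨s, hs, ⟨e⟩⟩ := hv.exists_in
          refine ⟨s, ⟨e⟩, fun s' e' => hQ.eq_of_in e' e f, by simp [hs], ?_⟩
          have hsx : s ≠ x := (hT.adj e).ne
          have : s ∈ x :: w := by
            rw [mem_iff_notMem_state hT, ← h, ← mem_iff_notMem_state hT]
            simp [hs]
          exact (List.mem_cons.1 this).resolve_left hsx
        rcases hocc with hocc | hocc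
        · exact aux hv h hocc
        · obtain ⟨s, h1, h2, h3, h4⟩ := aux hw h.symm hocc
          exact ⟨s, h1, h2, h4, h3⟩
      obtain ⟨s, ⟨e⟩, huniq, hsv, hsw⟩ := this
      have hsx : s ≠ x := (hT.adj e).ne
      rw [← hv.state_inter hQ e huniq hsv, ← hw.state_inter hQ e huniq hsw,
        ← state_cons_of_ne hsx v, h, state_cons_of_ne hsx]
    · rw [not_or] at hocc
      rw [state_of_notMem hocc.1, state_of_notMem hocc.2]
  · rw [← state_cons_of_ne hx v, h, state_cons_of_ne hx]

/-- Short words with the same state represent the same class: the first letter of one of them can be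
moved to the front in the other one, and can be cancelled on both sides. -/
theorem IsShort.wordClass_eq (hQ : IsAdmissibleTreeQuiver Q) {v w : List Q} (hv : IsShort v)
    (hw : IsShort w) (h : state v = state w) : wordClass v = wordClass w := by
  have hT := hQ.toIsTreeQuiver
  induction v generalizing w with
  | nil =>
    cases w with
    | nil => rfl
    | cons t w =>
      have : t ∈ ([] : List Q) := by
        rw [mem_iff_notMem_state hT, h, ← mem_iff_notMem_state hT]
        simp
      cases this
  | cons t v ih =>
    have ht : t ∈ w := by
      rw [mem_iff_notMem_state hT, ← h, ← mem_iff_notMem_state hT]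
      simp
    obtain ⟨a, b, rfl, hta⟩ := List.eq_append_cons_of_mem ht
    have hadj := not_adj_of_state_eq hQ hv hw hta h
    have hc : wordClass (a ++ t :: b) = wordClass (t :: (a ++ b)) := by
      rw [wordClass_append, wordClass_cons, wordClass_cons, ← mul_assoc,
        of_mul_wordClass_comm t a hadj, mul_assoc, wordClass_append]
    have hw' : IsShort (t :: (a ++ b)) := hw.congr hc.symm (by simp; omega)
    have hst : state (t :: (a ++ b)) = state (a ++ t :: b) := by
      funext x
      by_cases hx : x = t
      · subst hx
        rw [state_append_of_notMem hta]
        ext q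
        rw [mem_state_cons_self, mem_state_cons_self]
        refine exists_congr fun r => and_congr_right fun ⟨f⟩ => ?_
        rw [state_append_of_notMem fun hr => (hadj r hr).1.false f]
      · rw [state_cons_of_ne hx, state_append_cons_of_ne (fun s hs => (hadj s hs).2) b hx]
    rw [hc, wordClass_cons, wordClass_cons,
      ih hv.tail hw'.tail (state_eq_of_cons hQ hv hw' (h.trans hst.symm))]

end State

/-! ### Elements of modules over the path algebra -/

section PathElements

variable (k : Type w) [Field k] {Q : Type u} [Quiver.{v} Q]

/-- The trivial path at `t`, as an element of the path algebra. -/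
noncomputable def vert (t : Q) : PathAlgebra k Q := .single k ⟨t, t, .nil⟩

/-- An arrow, as an element of the path algebra. -/
noncomputable def arr {a b : Q} (e : a ⟶ b) : PathAlgebra k Q := .single k ⟨a, b, e.toPath⟩

theorem vert_mul_vert_self (t : Q) : vert k t * vert k t = vert k t :=
  PathAlgebra.single_comp k _ _

theorem vert_mul_vert_of_ne {s t : Q} (h : s ≠ t) : vert k s * vert k t = 0 :=
  PathAlgebra.single_mul_of_ne k h.symm

theorem vert_mul_arr {a b : Q} (e : a ⟶ b) : vert k b * arr k e = arr k e :=
  PathAlgebra.single_comp k _ _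

theorem single_cons {a b c : Q} (p : Quiver.Path a b) (e : b ⟶ c) :
    PathAlgebra.single k ⟨a, c, p.cons e⟩ = arr k e * PathAlgebra.single k ⟨a, b, p⟩ :=
  (PathAlgebra.single_comp k p e.toPath).symm

variable {k}
variable [Fintype Q] {M : Type*} [AddCommGroup M] [Module (PathAlgebra k Q) M]

theorem vert_smul_vert_smul (t : Q) (x : M) : vert k t • vert k t • x = vert k t • x := by
  rw [← mul_smul, vert_mul_vert_self]

theorem vert_smul_eq_zero {s t : Q} (h : s ≠ t) {x : M} (hx : vert k t • x = x) :
    vert k s • x = 0 := by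
  rw [← hx, ← mul_smul, vert_mul_vert_of_ne k h, zero_smul]

theorem vert_smul_arr_smul {a b : Q} (e : a ⟶ b) (x : M) :
    vert k b • arr k e • x = arr k e • x := by
  rw [← mul_smul, vert_mul_arr]

theorem sum_vert_smul (x : M) : ∑ t : Q, vert k t • x = x := by
  have h : (∑ t : Q, vert k t) = 1 := rfl
  rw [← Finset.sum_smul, h, one_smul]

/-- A submodule is determined by its components at the vertices. -/
theorem submodule_ext_vert {N N' : Submodule (PathAlgebra k Q) M}
    (h : ∀ (t : Q) (x : M), vert k t • x = x → (x ∈ N ↔ x ∈ N')) : N = N' := by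
  have aux : ∀ {N N' : Submodule (PathAlgebra k Q) M},
      (∀ (t : Q) (x : M), vert k t • x = x → (x ∈ N ↔ x ∈ N')) → N ≤ N' := by
    intro N N' h x hx
    rw [← sum_vert_smul (k := k) (Q := Q) x]
    exact sum_mem fun t _ => (h t _ (vert_smul_vert_smul (k := k) t x)).1 (N.smul_mem _ hx)
  exact le_antisymm (aux h) (aux fun t x hx => (h t x hx).symm)

theorem vertexHom_single_nil (t : Q) :
    vertexHom k t (.single k ⟨t, t, .nil⟩) = 1 := by
  classical
  exact (coeffNil_single k t _).trans (if_pos rfl)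

theorem vertexHom_single_of_ne {t a b : Q} (h : a ≠ t) (p : Quiver.Path a b) :
    vertexHom k t (.single k ⟨a, b, p⟩) = 0 := by
  classical
  exact (coeffNil_single k t _).trans (if_neg fun h' => h (congrArg Sigma.fst h'))

theorem vertexHom_single_cons {t a b c : Q} (p : Quiver.Path a b) (e : b ⟶ c) :
    vertexHom k t (.single k ⟨a, c, p.cons e⟩) = 0 := by
  classical
  exact (coeffNil_single k t _).trans (if_neg fun h' => by cases h')

theorem single_cons_smul_eq_zero {t : Q} {x : M} (hx : vert k t • x = x)
    (ha : ∀ (s : Q) (e : t ⟶ s), arr k e • x = 0) {b c : Q} (p : Quiver.Path t b) (e : b ⟶ c) :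
    PathAlgebra.single k ⟨t, c, p.cons e⟩ • x = 0 := by
  induction p generalizing c with
  | nil =>
    rw [single_cons, mul_smul]
    exact (congrArg (arr k e • ·) hx).trans (ha _ e)
  | cons p f ih => rw [single_cons, mul_smul, ih f, smul_zero]

/-- An element at `t` annihilated by all arrows starting at `t` spans a copy of `S_t`. -/
theorem smul_eq_vertexHom_smul {t : Q} {x : M} (hx : vert k t • x = x)
    (ha : ∀ (s : Q) (e : t ⟶ s), arr k e • x = 0) (z : PathAlgebra k Q) :
    z • x = algebraMap k (PathAlgebra k Q) (vertexHom k t z) • x := by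
  induction z using PathAlgebra.induction_on with
  | h0 => simp
  | hadd y z hy hz => rw [add_smul, hy, hz, map_add, map_add, add_smul]
  | hs c p =>
    suffices h : PathAlgebra.single k p • x =
        algebraMap k (PathAlgebra k Q) (vertexHom k t (.single k p)) • x by
      rw [map_smul, smul_eq_mul, map_mul, Algebra.smul_def, mul_smul, mul_smul, h]
    obtain ⟨a, b, p⟩ := p
    by_cases hat : a = t
    · subst hat
      cases p with
      | nil => rw [vertexHom_single_nil, map_one, one_smul]; exact hx
      | cons p e =>
        rw [vertexHom_single_cons, map_zero, zero_smul]
        exact single_cons_smul_eq_zero hx ha p e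
    · rw [vertexHom_single_of_ne hat, map_zero, zero_smul, ← hx, ← mul_smul]
      rw [show PathAlgebra.single k ⟨a, b, p⟩ * vert k t = 0 from
        PathAlgebra.single_mul_of_ne k (Ne.symm hat), zero_smul]

/-- The homomorphism from `S_t` determined by an element at `t` that is annihilated by all arrows
starting at `t`. -/
noncomputable def ofVertex {t : Q} (x : M) (hx : vert k t • x = x)
    (ha : ∀ (s : Q) (e : t ⟶ s), arr k e • x = 0) :
    VertexModule k t →ₗ[PathAlgebra k Q] M where
  toFun c := algebraMap k (PathAlgebra k Q) (vertexEquiv t c) • x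
  map_add' c d := by rw [map_add, map_add, add_smul]
  map_smul' z c := by
    rw [vertexEquiv_smul, mul_comm, map_mul, mul_smul, ← smul_eq_vertexHom_smul hx ha, ← mul_smul,
      ← mul_smul, Algebra.commutes, RingHom.id_apply]

theorem ofVertex_apply {t : Q} (x : M) (hx : vert k t • x = x)
    (ha : ∀ (s : Q) (e : t ⟶ s), arr k e • x = 0) (c : VertexModule k t) :
    ofVertex x hx ha c = algebraMap k (PathAlgebra k Q) (vertexEquiv t c) • x := rfl

theorem vert_smul_vertexModule (t : Q) (c : VertexModule k t) : vert k t • c = c := by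
  apply (vertexEquiv t).injective
  rw [vertexEquiv_smul, vert, vertexHom_single_nil, one_mul]

theorem arr_smul_vertexModule {t a b : Q} (e : a ⟶ b) (c : VertexModule k t) :
    arr k e • c = 0 := by
  apply (vertexEquiv t).injective
  rw [vertexEquiv_smul, arr, Quiver.Hom.toPath, vertexHom_single_cons, zero_mul, map_zero]

/-- The greatest submodule generated by `S_t`, elementwise. -/
theorem mem_genPart_vertexModule {t : Q} {x : M} :
    x ∈ genPart (PathAlgebra k Q) (VertexModule k t) M ↔
      vert k t • x = x ∧ ∀ (s : Q) (e : t ⟶ s), arr k e • x = 0 := by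
  constructor
  · intro h
    let W : Submodule (PathAlgebra k Q) M :=
      { carrier := {x | vert k t • x = x ∧ ∀ (s : Q) (e : t ⟶ s), arr k e • x = 0}
        add_mem' := fun ⟨h1, h2⟩ ⟨h3, h4⟩ =>
          ⟨by rw [smul_add, h1, h3], fun s e => by rw [smul_add, h2, h4, add_zero]⟩
        zero_mem' := ⟨smul_zero _, fun s e => smul_zero _⟩
        smul_mem' := fun z x ⟨h1, h2⟩ => by
          rw [smul_eq_vertexHom_smul h1 h2]
          refine ⟨?_, fun s e => ?_⟩
          · rw [← mul_smul, ← Algebra.commutes, mul_smul, h1]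
          · rw [← mul_smul, ← Algebra.commutes, mul_smul, h2, smul_zero] }
    have hW : genPart (PathAlgebra k Q) (VertexModule k t) M ≤ W := by
      refine sSup_le ?_
      rintro N ⟨d, f, hf⟩ y hy
      obtain ⟨c, hc⟩ := hf ⟨y, hy⟩
      have hy' : y = (f c : M) := by rw [hc]
      rw [hy']
      refine ⟨?_, fun s e => ?_⟩
      · rw [← Submodule.coe_smul, ← map_smul]
        congr 2
        funext i
        exact vert_smul_vertexModule t (c i)
      · rw [← Submodule.coe_smul, ← map_smul]
        have : arr k e • c = 0 := funext fun i => arr_smul_vertexModule e (c i)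
        rw [this, map_zero, Submodule.coe_zero]
    exact hW h
  · rintro ⟨hx, ha⟩
    refine Submodule.mem_sSup_of_mem (s := Submodule.span (PathAlgebra k Q) {x}) ?_
      (Submodule.mem_span_singleton_self x)
    refine ⟨1, ((ofVertex x hx ha).codRestrict (Submodule.span (PathAlgebra k Q) {x}) fun c =>
      Submodule.smul_mem _ _ (Submodule.mem_span_singleton_self x)).comp (LinearMap.proj 0), ?_⟩
    rintro ⟨y, hy⟩
    obtain ⟨z, rfl⟩ := Submodule.mem_span_singleton.1 hy
    refine ⟨fun _ => (vertexEquiv t).symm (vertexHom k t z), Subtype.ext ?_⟩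
    exact (congrArg (fun c => algebraMap k (PathAlgebra k Q) c • x)
      ((vertexEquiv t).apply_symm_apply _)).trans (smul_eq_vertexHom_smul hx ha z).symm

end PathElements

/-! ### Quotient functors of the identity -/

section QuotientFunctors

open scoped ModuleCat

variable {k : Type w} [Field k] {A : Type u} [Ring A] [Algebra k A]

/-- The kernel of a natural transformation starting at the identity functor. -/
def natKer {F : FDMod k A ⥤ FDMod k A} (η : 𝟭 (FDMod k A) ⟶ F) (M : FDMod k A) :
    Submodule A M.obj :=
  LinearMap.ker (η.app M).hom.hom

/-- Two quotient functors of the identity with the same kernels are isomorphic. -/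
theorem nonempty_iso_of_natKer_eq {F G : FDMod k A ⥤ FDMod k A} (η : 𝟭 (FDMod k A) ⟶ F)
    (θ : 𝟭 (FDMod k A) ⟶ G) (hη : ∀ M, Function.Surjective (η.app M).hom.hom)
    (hθ : ∀ M, Function.Surjective (θ.app M).hom.hom) (h : ∀ M, natKer η M = natKer θ M) :
    Nonempty (F ≅ G) := by
  let e (M : FDMod k A) : (F.obj M).obj ≃ₗ[A] (G.obj M).obj :=
    ((η.app M).hom.hom.quotKerEquivOfSurjective (hη M)).symm ≪≫ₗ
      Submodule.quotEquivOfEq _ _ (h M) ≪≫ₗ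
      (θ.app M).hom.hom.quotKerEquivOfSurjective (hθ M)
  have he (M : FDMod k A) (x : M.obj) : e M ((η.app M).hom.hom x) = (θ.app M).hom.hom x := by
    have : ((η.app M).hom.hom.quotKerEquivOfSurjective (hη M)).symm ((η.app M).hom.hom x) =
        Submodule.Quotient.mk x := by
      rw [LinearEquiv.symm_apply_eq]
      rfl
    change (θ.app M).hom.hom.quotKerEquivOfSurjective (hθ M)
      (Submodule.quotEquivOfEq _ _ (h M) (((η.app M).hom.hom.quotKerEquivOfSurjective (hη M)).symm
        ((η.app M).hom.hom x))) = _
    rw [this]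
    rfl
  refine ⟨NatIso.ofComponents (fun M => ObjectProperty.isoMk _ (e M).toModuleIso) ?_⟩
  intro M N f
  apply ObjectProperty.hom_ext
  apply ModuleCat.hom_ext
  refine LinearMap.ext fun y => ?_
  obtain ⟨x, rfl⟩ := hη M y
  have h1 : (F.map f).hom.hom ((η.app M).hom.hom x) = (η.app N).hom.hom (f.hom.hom x) :=
    congrArg (fun g : M ⟶ F.obj N => g.hom.hom x) (η.naturality f).symm
  have h2 : (G.map f).hom.hom ((θ.app M).hom.hom x) = (θ.app N).hom.hom (f.hom.hom x) :=
    congrArg (fun g : M ⟶ G.obj N => g.hom.hom x) (θ.naturality f).symm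
  change e N ((F.map f).hom.hom ((η.app M).hom.hom x)) =
    (G.map f).hom.hom (e M ((η.app M).hom.hom x))
  rw [h1, he, he, h2]

/-- The projection from the identity functor to a projection functor. -/
def projTrans (U : FDMod k A) : 𝟭 (FDMod k A) ⟶ projFunctor k U where
  app M := ObjectProperty.homMk (ModuleCat.ofHom (genPart A U.obj M.obj).mkQ)

theorem projTrans_surjective (U M : FDMod k A) :
    Function.Surjective ((projTrans U).app M).hom.hom :=
  Submodule.mkQ_surjective _

theorem natKer_projTrans (U M : FDMod k A) :
    natKer (projTrans U) M = genPart A U.obj M.obj :=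
  Submodule.ker_mkQ _

theorem EndoClass.mk_eq_mk {C : Type u} [Category.{v} C] {F G : C ⥤ C} :
    EndoClass.mk F = EndoClass.mk G ↔ Nonempty (F ≅ G) :=
  Quotient.eq (r := isIsomorphicSetoid (C ⥤ C))

end QuotientFunctors

/-! ### The functors attached to words -/

section WordFunctors

open scoped ModuleCat

variable (k : Type w) [Field k] {Q : Type u} [Quiver.{v} Q] [Fintype Q]

/-- The projection from the identity functor to the functor attached to a word. -/
noncomputable def wordTrans : (w : List Q) → 𝟭 (FDMod k (PathAlgebra k Q)) ⟶ wordFunctor k w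
  | [] => 𝟙 _
  | t :: w => wordTrans w ≫ Functor.whiskerLeft (wordFunctor k w) (projTrans (simpleAt k t))

variable {k}

theorem wordTrans_cons_apply (t : Q) (w : List Q) (M : FDMod k (PathAlgebra k Q)) (x : M.obj) :
    ((wordTrans k (t :: w)).app M).hom.hom x =
      ((projTrans (simpleAt k t)).app ((wordFunctor k w).obj M)).hom.hom
        (((wordTrans k w).app M).hom.hom x) := rfl

theorem wordTrans_surjective (w : List Q) (M : FDMod k (PathAlgebra k Q)) :
    Function.Surjective ((wordTrans k w).app M).hom.hom := by
  induction w with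
  | nil => exact Function.surjective_id
  | cons t w ih => exact (projTrans_surjective _ _).comp ih

/-- The kernel of the projection from `M` to the image of `M` under the functor attached to `w`. -/
noncomputable def wordKer (w : List Q) (M : FDMod k (PathAlgebra k Q)) :
    Submodule (PathAlgebra k Q) M.obj :=
  natKer (wordTrans k w) M

theorem mem_wordKer {w : List Q} {M : FDMod k (PathAlgebra k Q)} {x : M.obj} :
    x ∈ wordKer w M ↔ ((wordTrans k w).app M).hom.hom x = 0 := Iff.rfl

theorem mem_wordKer_nil {M : FDMod k (PathAlgebra k Q)} {x : M.obj} :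
    x ∈ wordKer [] M ↔ x = 0 := Iff.rfl

theorem mem_wordKer_cons {t : Q} {w : List Q} {M : FDMod k (PathAlgebra k Q)} {x : M.obj} :
    x ∈ wordKer (t :: w) M ↔
      vert k t • ((wordTrans k w).app M).hom.hom x = ((wordTrans k w).app M).hom.hom x ∧
        ∀ (s : Q) (e : t ⟶ s), arr k e • x ∈ wordKer w M := by
  rw [mem_wordKer, wordTrans_cons_apply]
  refine (SetLike.ext_iff.1 (natKer_projTrans (simpleAt k t) _) _).trans
    (mem_genPart_vertexModule.trans (and_congr_right fun _ => ?_))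
  refine forall₂_congr fun s e => ?_
  rw [mem_wordKer, map_smul]

/-- Applying the letter `t` does not change the kernel at the other vertices. -/
theorem mem_wordKer_cons_of_ne {t u : Q} (h : u ≠ t) {w : List Q}
    {M : FDMod k (PathAlgebra k Q)} {x : M.obj} (hx : vert k u • x = x) :
    x ∈ wordKer (t :: w) M ↔ x ∈ wordKer w M := by
  rw [mem_wordKer_cons]
  constructor
  · rintro ⟨h1, -⟩
    rw [mem_wordKer, ← h1, ← map_smul, vert_smul_eq_zero h.symm hx, map_zero]
  · intro h1
    refine ⟨?_, fun s e => Submodule.smul_mem _ _ h1⟩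
    rw [mem_wordKer] at h1
    rw [h1, smul_zero]

/-- After applying the letter `t`, the kernel at `t` consists of the elements that all arrows
starting at `t` move into the previous kernel; it does not depend on the previous kernel at `t`. -/
theorem mem_wordKer_cons_self {t : Q} {w : List Q}
    {M : FDMod k (PathAlgebra k Q)} {x : M.obj} (hx : vert k t • x = x) :
    x ∈ wordKer (t :: w) M ↔ ∀ (s : Q) (e : t ⟶ s), arr k e • x ∈ wordKer w M := by
  rw [mem_wordKer_cons, ← map_smul, hx]
  exact and_iff_right rfl

theorem nonempty_iso_of_wordKer_eq {v w : List Q}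
    (h : ∀ M : FDMod k (PathAlgebra k Q), wordKer v M = wordKer w M) :
    Nonempty (wordFunctor k v ≅ wordFunctor k w) :=
  nonempty_iso_of_natKer_eq _ _ (wordTrans_surjective v) (wordTrans_surjective w) h

theorem wordKer_idem (hQ : IsTreeQuiver Q) (s : Q) (M : FDMod k (PathAlgebra k Q)) :
    wordKer [s, s] M = wordKer [s] M := by
  refine submodule_ext_vert fun u x hx => ?_
  by_cases hu : u = s
  · subst hu
    rw [mem_wordKer_cons_self hx, mem_wordKer_cons_self hx]
    exact forall₂_congr fun r e =>
      mem_wordKer_cons_of_ne (hQ.adj e).ne' (vert_smul_arr_smul e x)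
  · rw [mem_wordKer_cons_of_ne hu hx]

theorem wordKer_kiselman (hQ : IsTreeQuiver Q) (s t : Q) (h : IsEmpty (t ⟶ s))
    (M : FDMod k (PathAlgebra k Q)) : wordKer [t, s, t] M = wordKer [s, t] M := by
  refine submodule_ext_vert fun u x hx => ?_
  by_cases hu : u = t
  · subst hu
    by_cases hs : u = s
    · subst hs
      rw [mem_wordKer_cons_self hx, mem_wordKer_cons_self hx]
      exact forall₂_congr fun r e =>
        mem_wordKer_cons_of_ne (hQ.adj e).ne' (vert_smul_arr_smul e x)
    · rw [mem_wordKer_cons_self hx, mem_wordKer_cons_of_ne hs hx, mem_wordKer_cons_self hx]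
      refine forall₂_congr fun r e => ?_
      have hrs : r ≠ s := by
        rintro rfl
        exact h.false e
      rw [mem_wordKer_cons_of_ne hrs (vert_smul_arr_smul e x),
        mem_wordKer_cons_of_ne (hQ.adj e).ne' (vert_smul_arr_smul e x)]
  · rw [mem_wordKer_cons_of_ne hu hx]

/-- If there is no arrow from `t` to `s`, then both sides of the braid relation equal `s t`. -/
theorem wordKer_braid_aux (hQ : IsTreeQuiver Q) (s t : Q) (h : IsEmpty (t ⟶ s))
    (M : FDMod k (PathAlgebra k Q)) : wordKer [s, t, s] M = wordKer [s, t] M := by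
  by_cases hst : s = t
  · subst hst
    exact wordKer_kiselman hQ s s h M
  have ht : ∀ x : M.obj, vert k t • x = x → (x ∈ wordKer [t, s] M ↔ x ∈ wordKer [t] M) := by
    intro x hx
    rw [mem_wordKer_cons_self hx, mem_wordKer_cons_self hx]
    refine forall₂_congr fun r e => ?_
    have hrs : r ≠ s := by
      rintro rfl
      exact h.false e
    rw [mem_wordKer_cons_of_ne hrs (vert_smul_arr_smul e x)]
  refine submodule_ext_vert fun u x hx => ?_
  by_cases hus : u = s
  · subst hus
    rw [mem_wordKer_cons_self hx, mem_wordKer_cons_self hx]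
    refine forall₂_congr fun r e => ?_
    by_cases hrt : r = t
    · subst hrt
      exact ht _ (vert_smul_arr_smul (k := k) e x)
    · have hr := vert_smul_arr_smul (k := k) e x
      rw [mem_wordKer_cons_of_ne hrt hr, mem_wordKer_cons_of_ne (hQ.adj e).ne' hr,
        mem_wordKer_cons_of_ne hrt hr]
  · rw [mem_wordKer_cons_of_ne hus hx, mem_wordKer_cons_of_ne hus hx]
    by_cases hut : u = t
    · subst hut
      exact ht x hx
    · rw [mem_wordKer_cons_of_ne hut hx, mem_wordKer_cons_of_ne hus hx,
        mem_wordKer_cons_of_ne hut hx]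

theorem wordKer_braid (hQ : IsTreeQuiver Q) (s t : Q) (M : FDMod k (PathAlgebra k Q)) :
    wordKer [s, t, s] M = wordKer [t, s, t] M := by
  by_cases h : Nonempty (t ⟶ s)
  · have h' := hQ.isEmpty_symm t s h
    rw [wordKer_kiselman hQ t s h', wordKer_braid_aux hQ t s h']
  · rw [not_nonempty_iff] at h
    rw [wordKer_kiselman hQ s t h, wordKer_braid_aux hQ s t h]

end WordFunctors

/-! ### Modules that detect the state of a word -/

section StateModules

variable (k : Type w) [Field k] {Q : Type u} [Quiver.{v} Q] [Fintype Q]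

open Classical in
/-- The matrix by which a path acts on `StateModule k q`. The vertices are numbered in order to
obtain a module in the universe of `k`. -/
noncomputable def pathMatrix (q : Q) (p : PathIn Q) :
    Matrix (Fin (Fintype.card Q)) (Fin (Fintype.card Q)) k :=
  if p.2.2.length = 0 ∨ Nonempty (Quiver.Path p.2.1 q) then
    Matrix.single (Fintype.equivFin Q p.2.1) (Fintype.equivFin Q p.1) 1 else 0

theorem pathMatrix_comp (q : Q) {a b c : Q} (p : Quiver.Path a b) (p' : Quiver.Path b c) :
    pathMatrix k q ⟨b, c, p'⟩ * pathMatrix k q ⟨a, b, p⟩ = pathMatrix k q ⟨a, c, p.comp p'⟩ := by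
  have h : (p.comp p').length = 0 ∨ Nonempty (Quiver.Path c q) ↔
      (p'.length = 0 ∨ Nonempty (Quiver.Path c q)) ∧
        (p.length = 0 ∨ Nonempty (Quiver.Path b q)) := by
    have h1 : Nonempty (Quiver.Path c q) → Nonempty (Quiver.Path b q) :=
      fun ⟨r⟩ => ⟨p'.comp r⟩
    have h2 : p'.length = 0 → Nonempty (Quiver.Path b q) → Nonempty (Quiver.Path c q) := by
      intro h0 hb
      cases p' with
      | nil => exact hb
      | cons p' e => simp at h0
    rw [Quiver.Path.length_comp, Nat.add_eq_zero_iff]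
    tauto
  unfold pathMatrix
  simp only [h]
  split_ifs <;> simp_all

theorem pathMatrix_mul_of_ne (q : Q) {p p' : PathIn Q} (h : p.2.1 ≠ p'.1) :
    pathMatrix k q p' * pathMatrix k q p = 0 := by
  unfold pathMatrix
  split_ifs
  · exact Matrix.single_mul_single_of_ne _ _ _ _
      (fun h' => h ((Fintype.equivFin Q).injective h').symm) _
  all_goals simp

/-- The linear extension of `pathMatrix`. -/
noncomputable def pathMatrixLin (q : Q) :
    PathAlgebra k Q →ₗ[k] Matrix (Fin (Fintype.card Q)) (Fin (Fintype.card Q)) k :=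
  (Finsupp.linearCombination k (pathMatrix k q) : (PathIn Q →₀ k) →ₗ[k] _)

theorem pathMatrixLin_single (q : Q) (p : PathIn Q) :
    pathMatrixLin k q (PathAlgebra.single k p) = pathMatrix k q p :=
  (Finsupp.linearCombination_single k _ _).trans (one_smul _ _)

/-- The representation of the path algebra on `StateModule k q`. -/
noncomputable def pathRep (q : Q) :
    PathAlgebra k Q →ₐ[k] Matrix (Fin (Fintype.card Q)) (Fin (Fintype.card Q)) k :=
  AlgHom.ofLinearMap (pathMatrixLin k q)
    (by
      rw [PathAlgebra.one_def, map_sum]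
      simp only [pathMatrixLin_single]
      rw [← Matrix.diagonal_one, ← Matrix.sum_single_eq_diagonal]
      refine Fintype.sum_equiv (Fintype.equivFin Q) _ _ fun a => ?_
      simp [pathMatrix])
    (by
      intro x y
      induction x using PathAlgebra.induction_on with
      | h0 => simp
      | hadd x x' h h' => simp only [add_mul, map_add, h, h']
      | hs c p =>
      induction y using PathAlgebra.induction_on with
      | h0 => simp
      | hadd x x' h h' => simp only [mul_add, map_add, h, h']
      | hs c' p' =>
      rw [smul_mul_smul_comm, map_smul, map_smul, map_smul, smul_mul_smul_comm]
      congr 1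
      obtain ⟨a, b, p⟩ := p
      obtain ⟨c, d, p'⟩ := p'
      rw [pathMatrixLin_single, pathMatrixLin_single]
      by_cases h : d = a
      · subst h
        rw [PathAlgebra.single_comp, pathMatrixLin_single, pathMatrix_comp]
      · rw [pathMatrix_mul_of_ne k q h,
          PathAlgebra.single_mul_of_ne k (q := ⟨a, b, p⟩) (p := ⟨c, d, p'⟩) h, map_zero])

theorem pathRep_single (q : Q) (p : PathIn Q) :
    pathRep k q (PathAlgebra.single k p) = pathMatrix k q p :=
  pathMatrixLin_single k q p

/-- The module with a one-dimensional component at each vertex, on which an arrow acts as the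
identity if `q` can be reached from its target, and as zero otherwise. For a tree it is the direct
sum of the injective hull of `S_q` and of the simple modules at those vertices from which `q` cannot
be reached. -/
@[nolint unusedArguments]
def StateModule (k : Type w) {Q : Type u} [Fintype Q] (_q : Q) : Type w :=
  Fin (Fintype.card Q) → k

noncomputable instance (q : Q) : AddCommGroup (StateModule k q) :=
  inferInstanceAs (AddCommGroup (Fin (Fintype.card Q) → k))

noncomputable instance (q : Q) : Module (PathAlgebra k Q) (StateModule k q) :=
  Module.compHom (Fin (Fintype.card Q) → k)
    ((Matrix.toLinAlgEquiv' (R := k) (n := Fin (Fintype.card Q))).toAlgHom.comp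
      (pathRep k q)).toRingHom

/-- The identity, as an additive equivalence between `StateModule k q` and the coordinate space. -/
noncomputable def stateEquiv (q : Q) : StateModule k q ≃+ (Fin (Fintype.card Q) → k) := AddEquiv.refl _

theorem stateEquiv_smul (q : Q) (z : PathAlgebra k Q) (f : StateModule k q) :
    stateEquiv k q (z • f) = (pathRep k q z).mulVec (stateEquiv k q f) := rfl

theorem stateEquiv_algebraMap_smul (q : Q) (c : k) (f : StateModule k q) :
    stateEquiv k q (algebraMap k (PathAlgebra k Q) c • f) = c • stateEquiv k q f := by
  rw [stateEquiv_smul, AlgHom.commutes, Algebra.algebraMap_eq_smul_one, Matrix.smul_mulVec,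
    Matrix.one_mulVec]

open scoped ModuleCat in
theorem finiteDimensional_of_addHom {A : Type u} [Ring A] [Algebra k A] (M : ModuleCat.{w} A)
    {n : ℕ} (f : (Fin n → k) →+ M) (hf : ∀ c x, f (c • x) = algebraMap k A c • f x)
    (h : Function.Surjective f) : FiniteDimensional k M :=
  Module.Finite.of_surjective ({ f with map_smul' := hf } : (Fin n → k) →ₗ[k] M) h

/-- `StateModule k q` as an object of the category of finite-dimensional modules. -/
noncomputable def stateObj (q : Q) : FDMod k (PathAlgebra k Q) :=
  ⟨ModuleCat.of (PathAlgebra k Q) (StateModule k q),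
    finiteDimensional_of_addHom k _ (stateEquiv k q).symm.toAddMonoidHom
      (fun c x => (stateEquiv k q).injective (by
        refine Eq.trans ?_ (stateEquiv_algebraMap_smul k q c ((stateEquiv k q).symm x)).symm
        exact ((stateEquiv k q).apply_symm_apply _).trans
          (congrArg _ ((stateEquiv k q).apply_symm_apply _).symm)))
      (stateEquiv k q).symm.surjective⟩

/-- The basis vector of `StateModule k q` at the vertex `t`. -/
noncomputable def stateBasis (q t : Q) : (stateObj k q).obj :=
  (stateEquiv k q).symm (Pi.single (Fintype.equivFin Q t) 1)

theorem stateEquiv_stateBasis (q t : Q) :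
    stateEquiv k q (stateBasis k q t) = Pi.single (Fintype.equivFin Q t) 1 :=
  (stateEquiv k q).apply_symm_apply _

theorem stateBasis_ne_zero (q t : Q) : stateBasis k q t ≠ 0 := by
  intro h
  have h1 := (stateEquiv_stateBasis k q t).symm.trans
    ((congrArg (stateEquiv k q) h).trans (map_zero (stateEquiv k q)))
  have h2 := congrFun h1 (Fintype.equivFin Q t)
  rw [Pi.single_eq_same] at h2
  exact one_ne_zero h2

theorem exists_vert_smul_eq (q t : Q) (f : (stateObj k q).obj) :
    ∃ c : k, vert k t • f = algebraMap k (PathAlgebra k Q) c • stateBasis k q t := by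
  refine ⟨stateEquiv k q f (Fintype.equivFin Q t), (stateEquiv k q).injective ?_⟩
  refine (stateEquiv_smul k q _ f).trans (Eq.trans ?_
    (stateEquiv_algebraMap_smul k q _ (stateBasis k q t)).symm)
  rw [stateEquiv_stateBasis, vert, pathRep_single]
  simp only [pathMatrix, Quiver.Path.length_nil, true_or, if_true]
  rw [Matrix.single_mulVec, one_mul]
  funext i
  simp [Function.update_apply, Pi.single_apply]

theorem vert_smul_stateBasis (q t : Q) : vert k t • stateBasis k q t = stateBasis k q t := by
  refine (stateEquiv k q).injective ((stateEquiv_smul k q _ (stateBasis k q t)).trans ?_)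
  rw [stateEquiv_stateBasis, vert, pathRep_single]
  simp only [pathMatrix, Quiver.Path.length_nil, true_or, if_true]
  rw [Matrix.single_mulVec, one_mul]
  funext i
  simp [Function.update_apply, Pi.single_apply]

theorem arr_smul_stateBasis (q : Q) {t r : Q} (e : t ⟶ r) (h : Nonempty (Quiver.Path r q)) :
    arr k e • stateBasis k q t = stateBasis k q r := by
  refine (stateEquiv k q).injective ((stateEquiv_smul k q _ (stateBasis k q t)).trans ?_)
  rw [stateEquiv_stateBasis, stateEquiv_stateBasis, arr, pathRep_single]
  simp only [pathMatrix, h, or_true, if_true]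
  rw [Matrix.single_mulVec, one_mul]
  funext i
  simp [Function.update_apply, Pi.single_apply]

theorem arr_smul_stateBasis_eq_zero (q : Q) {t r : Q} (e : t ⟶ r)
    (h : ¬ Nonempty (Quiver.Path r q)) : arr k e • stateBasis k q t = 0 := by
  refine (stateEquiv k q).injective ((stateEquiv_smul k q _ (stateBasis k q t)).trans ?_)
  rw [arr, pathRep_single, pathMatrix, if_neg (by simp [h, Quiver.Hom.toPath]), Matrix.zero_mulVec]
  exact (map_zero (stateEquiv k q)).symm

variable {k}

/-- The module-theoretic meaning of the state of a word. -/
theorem mem_state_iff {t q : Q} (h : Nonempty (Quiver.Path t q)) (w : List Q) :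
    q ∈ state w t ↔
      stateBasis k q t ∉ wordKer w (stateObj k q) := by
  induction w generalizing t with
  | nil => exact iff_of_true h fun h' => stateBasis_ne_zero k q t (mem_wordKer_nil.1 h')
  | cons s w ih =>
    have hb := vert_smul_stateBasis k q t
    by_cases hts : t = s
    · subst hts
      rw [mem_state_cons_self, mem_wordKer_cons_self hb]
      push Not
      refine exists_congr fun r => ⟨fun ⟨⟨e⟩, hr⟩ => ⟨e, ?_⟩, fun ⟨e, hr⟩ => ⟨⟨e⟩, ?_⟩⟩
      · have hp := path_of_mem_state hr
        exact (arr_smul_stateBasis k q e hp).symm ▸ (ih hp).1 hr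
      · by_cases hp : Nonempty (Quiver.Path r q)
        · rw [ih hp]
          exact arr_smul_stateBasis k q e hp ▸ hr
        · exact absurd ((arr_smul_stateBasis_eq_zero k q e hp).symm ▸ zero_mem _) hr
    · rw [state_cons_of_ne hts, mem_wordKer_cons_of_ne hts hb, ih h]

theorem stateBasis_mem_wordKer_iff (q t : Q) (w : List Q) :
    stateBasis k q t ∈ wordKer w (stateObj k q) ↔
      ∀ y : ((wordFunctor k w).obj (stateObj k q)).obj, vert k t • y = 0 := by
  constructor
  · intro h y
    obtain ⟨x, rfl⟩ := wordTrans_surjective w (stateObj k q) y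
    rw [← map_smul]
    obtain ⟨c, hc⟩ := exists_vert_smul_eq k q t x
    rw [hc]
    exact Submodule.smul_mem _ _ h
  · intro h
    have hb := vert_smul_stateBasis k q t
    rw [mem_wordKer, ← hb, map_smul]
    exact h _

/-- The isomorphism classes of the values of the functor attached to a word determine its state. -/
theorem state_eq_of_iso {v w : List Q}
    (h : ∀ V : FDMod k (PathAlgebra k Q),
      Nonempty ((wordFunctor k v).obj V ≅ (wordFunctor k w).obj V)) :
    state v = state w := by
  have aux : ∀ {v w : List Q} (q t : Q),
      Nonempty ((wordFunctor k v).obj (stateObj k q) ≅ (wordFunctor k w).obj (stateObj k q)) →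
      stateBasis k q t ∈ wordKer v (stateObj k q) →
      stateBasis k q t ∈ wordKer w (stateObj k q) := by
    rintro v w q t ⟨φ⟩ hv
    rw [stateBasis_mem_wordKer_iff] at hv ⊢
    intro y
    have hy : φ.hom.hom.hom (φ.inv.hom.hom y) = y :=
      congrArg (fun g : (wordFunctor k w).obj (stateObj k q) ⟶ _ => g.hom.hom y) φ.inv_hom_id
    rw [← hy, ← map_smul, hv, map_zero]
  funext t
  ext q
  by_cases hp : Nonempty (Quiver.Path t q)
  · rw [mem_state_iff (k := k) hp, mem_state_iff (k := k) hp]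
    exact not_congr ⟨aux q t (h _), aux q t ((h _).map Iso.symm)⟩
  · exact iff_of_false (fun h => hp (path_of_mem_state h)) fun h => hp (path_of_mem_state h)

end StateModules

/-! ### Simple modules over the path algebra of a tree -/

section Simples

variable {k : Type w} [Field k] {Q : Type u} [Quiver.{v} Q] [Fintype Q]

/-- Every nonempty set of vertices of a finite tree quiver contains a vertex without out-neighbours
in that set. -/
theorem IsTreeQuiver.exists_forall_isEmpty (hQ : IsTreeQuiver Q) {T : Set Q} (hT : T.Nonempty) :
    ∃ t ∈ T, ∀ s ∈ T, IsEmpty (t ⟶ s) := by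
  let r : Q → Q → Prop := fun s t => ∃ a, Nonempty (t ⟶ a) ∧ Nonempty (Quiver.Path a s)
  have : IsTrans Q r := ⟨fun a b c ⟨x, ⟨e⟩, ⟨p⟩⟩ ⟨y, ⟨e'⟩, ⟨p'⟩⟩ =>
    ⟨y, ⟨e'⟩, ⟨p'.comp (e.toPath.comp p)⟩⟩⟩
  have : Std.Irrefl r := ⟨fun a ⟨x, ⟨e⟩, ⟨p⟩⟩ => (hQ.isEmpty_path e).false p⟩
  obtain ⟨t, ht, hmin⟩ := (Finite.wellFounded_of_trans_of_irrefl r).has_min T hT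
  exact ⟨t, ht, fun s hs => ⟨fun e => hmin s hs ⟨s, ⟨e⟩, ⟨.nil⟩⟩⟩⟩

theorem exists_linearEquiv_vertexModule (hQ : IsTreeQuiver Q) (S : Type*) [AddCommGroup S]
    [Module (PathAlgebra k Q) S] [IsSimpleModule (PathAlgebra k Q) S] :
    ∃ t : Q, Nonempty (VertexModule k t ≃ₗ[PathAlgebra k Q] S) := by
  have := IsSimpleModule.nontrivial (PathAlgebra k Q) S
  obtain ⟨y, hy⟩ := exists_ne (0 : S)
  have hT : {t : Q | ∃ x : S, vert k t • x ≠ 0}.Nonempty := by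
    by_contra! h
    apply hy
    rw [← sum_vert_smul (k := k) (Q := Q) y]
    refine Finset.sum_eq_zero fun t _ => ?_
    by_contra ht
    have : t ∈ {t : Q | ∃ x : S, vert k t • x ≠ 0} := ⟨y, ht⟩
    rw [h] at this
    exact this
  -- All arrows starting at such a vertex `t` annihilate the component of `S` at `t`.
  obtain ⟨t, ⟨x, hx⟩, ht⟩ := hQ.exists_forall_isEmpty hT
  refine ⟨t, ⟨LinearEquiv.ofBijective
    (ofVertex (vert k t • x) (vert_smul_vert_smul t x) fun s e => ?_)
    (LinearMap.bijective_of_ne_zero fun h0 => hx ?_)⟩⟩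
  · rw [← vert_smul_arr_smul]
    by_contra h
    exact (ht s ⟨_, h⟩).false e
  · have h1 := LinearMap.congr_fun h0 ((vertexEquiv t).symm 1)
    rw [ofVertex_apply, AddEquiv.apply_symm_apply, map_one, one_smul] at h1
    exact h1

theorem Gen.congr {A U U' N : Type*} [Ring A] [AddCommGroup U] [Module A U]
    [AddCommGroup U'] [Module A U'] [AddCommGroup N] [Module A N] (e : U ≃ₗ[A] U')
    (h : Gen A U N) : Gen A U' N := by
  obtain ⟨d, f, hf⟩ := h
  refine ⟨d, f.comp (LinearEquiv.piCongrRight fun _ => e.symm).toLinearMap, ?_⟩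
  exact hf.comp (LinearEquiv.surjective _)

theorem genPart_congr {A U U' : Type*} [Ring A] (M : Type*) [AddCommGroup U] [Module A U]
    [AddCommGroup U'] [Module A U'] [AddCommGroup M] [Module A M] (e : U ≃ₗ[A] U') :
    genPart A U M = genPart A U' M :=
  congrArg sSup (Set.ext fun _ => ⟨Gen.congr e, Gen.congr e.symm⟩)

theorem exists_mk_projFunctor_eq (hQ : IsTreeQuiver Q) (S : FDMod k (PathAlgebra k Q))
    (hS : IsSimpleModule (PathAlgebra k Q) S.obj) :
    ∃ t : Q, EndoClass.mk (projFunctor k S) = EndoClass.mk (vertexFunctor k t) := by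
  obtain ⟨t, ⟨e⟩⟩ := exists_linearEquiv_vertexModule (k := k) hQ S.obj
  refine ⟨t, EndoClass.mk_eq_mk.2 (nonempty_iso_of_natKer_eq (projTrans S)
    (projTrans (simpleAt k t)) (projTrans_surjective _) (projTrans_surjective _) fun M => ?_)⟩
  exact (natKer_projTrans S M).trans ((genPart_congr M.obj e.symm).trans
    (natKer_projTrans (simpleAt k t) M).symm)

end Simples

/-! ### The presentation of the monoid of projection functors -/

section Presentation

variable {k : Type w} [Field k] {Q : Type u} [Quiver.{v} Q] [Fintype Q]

theorem coe_lift_vertexClass (w : FreeMonoid Q) :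
    (FreeMonoid.lift (vertexClass k) w : EndoClass (FDMod k (PathAlgebra k Q))) =
      EndoClass.mk (wordFunctor k w.toList) := by
  induction w using FreeMonoid.inductionOn' with
  | one => rfl
  | of_mul t w ih =>
    rw [map_mul, Submonoid.coe_mul, ih, FreeMonoid.lift_eval_of]
    rfl

/-- The homomorphism from the presented monoid to the monoid of projection functors. -/
noncomputable def presentedHom (k : Type w) [Field k] (hQ : IsTreeQuiver Q) :
    PresentedMonoid (WordRel Q) →* projMonoid k (PathAlgebra k Q) :=
  PresentedMonoid.lift (vertexClass k) (by
    intro a b h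
    apply Subtype.ext
    rw [coe_lift_vertexClass, coe_lift_vertexClass, EndoClass.mk_eq_mk]
    apply nonempty_iso_of_wordKer_eq
    intro M
    cases h with
    | idem s => exact wordKer_idem hQ s M
    | braid s t => exact wordKer_braid hQ s t M
    | kiselman s t h => exact wordKer_kiselman hQ s t h M)

theorem coe_presentedHom_wordClass (hQ : IsTreeQuiver Q) (w : List Q) :
    (presentedHom k hQ (wordClass w) : EndoClass (FDMod k (PathAlgebra k Q))) =
      EndoClass.mk (wordFunctor k w) :=
  coe_lift_vertexClass (FreeMonoid.ofList w)

theorem nonempty_iso_of_wordClass_eq (hQ : IsTreeQuiver Q) {v w : List Q}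
    (h : wordClass v = wordClass w) : Nonempty (wordFunctor k v ≅ wordFunctor k w) := by
  rw [← EndoClass.mk_eq_mk, ← coe_presentedHom_wordClass hQ, h, coe_presentedHom_wordClass]

/-- Words whose functors have isomorphic values at every module are equal in the presented monoid. -/
theorem wordClass_eq_of_iso (hQ : IsAdmissibleTreeQuiver Q) {v w : List Q}
    (h : ∀ V : FDMod k (PathAlgebra k Q),
      Nonempty ((wordFunctor k v).obj V ≅ (wordFunctor k w).obj V)) :
    wordClass v = wordClass w := by
  obtain ⟨v', hv', hv⟩ := exists_isShort v
  obtain ⟨w', hw', hw⟩ := exists_isShort w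
  rw [← hv, ← hw]
  refine hv'.wordClass_eq hQ hw' (state_eq_of_iso (k := k) fun V => ?_)
  obtain ⟨e⟩ := nonempty_iso_of_wordClass_eq (k := k) hQ.toIsTreeQuiver hv
  obtain ⟨f⟩ := nonempty_iso_of_wordClass_eq (k := k) hQ.toIsTreeQuiver hw
  obtain ⟨g⟩ := h V
  exact ⟨e.app V ≪≫ g ≪≫ (f.app V).symm⟩

theorem presentedHom_injective (hQ : IsAdmissibleTreeQuiver Q) :
    Function.Injective (presentedHom k hQ.toIsTreeQuiver) := by
  intro x y h
  induction x, y using PresentedMonoid.inductionOn₂ with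
  | h a b =>
  have h1 := congrArg Subtype.val h
  have ha := coe_presentedHom_wordClass (k := k) hQ.toIsTreeQuiver a.toList
  have hb := coe_presentedHom_wordClass (k := k) hQ.toIsTreeQuiver b.toList
  obtain ⟨e⟩ := EndoClass.mk_eq_mk.1 (ha.symm.trans (h1.trans hb))
  exact wordClass_eq_of_iso (k := k) hQ fun V => ⟨e.app V⟩

/-- Every simple module is isomorphic to some `S_t`, so the generators `[F_t]` suffice. -/
theorem presentedHom_surjective (hQ : IsTreeQuiver Q) :
    Function.Surjective (presentedHom k hQ) := by
  rintro ⟨c, hc⟩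
  suffices h : c ∈ MonoidHom.mrange ((projMonoid k (PathAlgebra k Q)).subtype.comp
      (presentedHom k hQ)) by
    obtain ⟨x, hx⟩ := h
    exact ⟨x, Subtype.ext hx⟩
  refine Submonoid.closure_le.2 ?_ hc
  rintro _ ⟨S, hS, rfl⟩
  obtain ⟨t, ht⟩ := exists_mk_projFunctor_eq hQ S hS
  exact ⟨.of _ t, ht.symm⟩

end Presentation

/-! ### The algebra given by the relations -/

section Algebra

variable (k : Type w) [Field k] (Q : Type u) [Quiver.{v} Q]

/-- The homomorphism from the presented monoid to the multiplicative monoid of `B_Q`. -/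
noncomputable def presentedToBAlgebra : PresentedMonoid (WordRel Q) →* BAlgebra k Q :=
  PresentedMonoid.lift (gen k) (by
    intro a b h
    cases h with
    | idem s =>
      simpa [gen] using RingQuot.mkAlgHom_rel k (AlgRel.idem (k := k) s)
    | braid s t =>
      simpa [gen] using RingQuot.mkAlgHom_rel k (AlgRel.braid (k := k) s t)
    | kiselman s t h =>
      simpa [gen] using RingQuot.mkAlgHom_rel k (AlgRel.kiselman (k := k) s t h))

theorem presentedToBAlgebra_of (t : Q) : presentedToBAlgebra k Q (.of _ t) = gen k t := rfl

theorem presentedToBAlgebra_wordClass (w : FreeMonoid Q) :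
    presentedToBAlgebra k Q (wordClass w.toList) = monomial k w := rfl

/-- The homomorphism from `B_Q` to the monoid algebra of the presented monoid. -/
noncomputable def bAlgebraHom : BAlgebra k Q →ₐ[k] MonoidAlgebra k (PresentedMonoid (WordRel Q)) :=
  RingQuot.liftAlgHom k
    ⟨FreeAlgebra.lift k fun t => MonoidAlgebra.of k _ (PresentedMonoid.of (WordRel Q) t), by
      intro x y h
      cases h with
      | idem s =>
        rw [map_mul, FreeAlgebra.lift_ι_apply, ← map_mul, of_mul_self]
      | braid s t =>
        simp only [map_mul, FreeAlgebra.lift_ι_apply]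
        rw [← map_mul, ← map_mul, of_braid, map_mul, map_mul]
      | kiselman s t h =>
        simp only [map_mul, FreeAlgebra.lift_ι_apply]
        rw [← map_mul, ← map_mul, of_kiselman s t h, map_mul]⟩

theorem bAlgebraHom_gen (t : Q) : bAlgebraHom k Q (gen k t) = MonoidAlgebra.of k _ (.of _ t) := by
  rw [bAlgebraHom, gen, RingQuot.liftAlgHom_mkAlgHom_apply, FreeAlgebra.lift_ι_apply]

/-- `B_Q` is the monoid algebra of the presented monoid. -/
noncomputable def bAlgebraEquiv :
    BAlgebra k Q ≃ₐ[k] MonoidAlgebra k (PresentedMonoid (WordRel Q)) :=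
  AlgEquiv.ofAlgHom (bAlgebraHom k Q) (MonoidAlgebra.lift k _ _ (presentedToBAlgebra k Q))
    (by
      refine MonoidAlgebra.algHom_ext' ?_ (Subsingleton.elim _ _)
      apply PresentedMonoid.ext
      intro t
      change bAlgebraHom k Q (MonoidAlgebra.lift k _ _ (presentedToBAlgebra k Q)
        (MonoidAlgebra.of k _ (.of _ t))) = MonoidAlgebra.of k _ (.of _ t)
      rw [MonoidAlgebra.lift_of, presentedToBAlgebra_of, bAlgebraHom_gen])
    (by
      refine RingQuot.ringQuot_ext' k _ _ (FreeAlgebra.hom_ext (funext fun t => ?_))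
      change MonoidAlgebra.lift k _ _ (presentedToBAlgebra k Q) (bAlgebraHom k Q (gen k t)) =
        gen k t
      rw [bAlgebraHom_gen, MonoidAlgebra.lift_of, presentedToBAlgebra_of])

theorem bAlgebraEquiv_gen (t : Q) :
    bAlgebraEquiv k Q (gen k t) = MonoidAlgebra.of k _ (.of _ t) :=
  bAlgebraHom_gen k Q t

end Algebra

/-! ### Normal forms -/

section NormalForm

variable {Q : Type u} [Quiver.{v} Q] [Fintype Q]

theorem mem_iff_of_wordClass_eq (k : Type w) [Field k] (hQ : IsTreeQuiver Q) {v w : List Q}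
    (h : wordClass v = wordClass w) (t : Q) : t ∈ v ↔ t ∈ w := by
  obtain ⟨e⟩ := nonempty_iso_of_wordClass_eq (k := k) hQ h
  rw [mem_iff_notMem_state hQ, mem_iff_notMem_state hQ,
    state_eq_of_iso (k := k) fun V => ⟨e.app V⟩]

/-- The empty word and the one-letter words represent different elements of the presented monoid. -/
theorem wordClass_injOn (k : Type w) [Field k] (hQ : IsTreeQuiver Q) :
    Set.InjOn (wordClass : List Q → _) {w | w.length ≤ 1} := by
  intro v hv w hw h
  have hmem := mem_iff_of_wordClass_eq k hQ h
  match v, w, hv, hw with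
  | [], [], _, _ => rfl
  | [], [t], _, _ => simpa using hmem t
  | [s], [], _, _ => simpa using hmem s
  | [s], [t], _, _ => simpa using hmem s

/-- Any system of representatives for the classes of words that contains the words of length at
most one is an admissible normal form. -/
theorem exists_isAdmissibleNormalForm (k : Type w) [Field k] (hQ : IsAdmissibleTreeQuiver Q) :
    ∃ W : Set (FreeMonoid Q), IsAdmissibleNormalForm k W := by
  obtain ⟨W, hW, hbij⟩ := (wordClass_injOn k hQ.toIsTreeQuiver).bijOn_image.exists_extend
    (Set.subset_univ _) fun x _ => (PresentedMonoid.surjective_mk x).imp fun _ h => h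
  refine ⟨{w | w.toList ∈ W}, hW (Nat.zero_le 1), fun t => hW (Nat.le_refl 1), fun w _ t => ?_,
    fun v hv w hw hvw => ?_⟩
  · obtain ⟨w', hw', h⟩ := hbij.surjOn (Set.mem_univ (wordClass (w.toList ++ [t])))
    refine ⟨FreeMonoid.ofList w', hw', ?_⟩
    rw [← presentedToBAlgebra_wordClass, ← presentedToBAlgebra_wordClass, FreeMonoid.toList_ofList,
      h, wordClass_append, map_mul, wordClass_singleton, presentedToBAlgebra_of]
  · by_contra! h
    exact hvw (hbij.injOn hv hw (wordClass_eq_of_iso (k := k) hQ h))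

end NormalForm

end ProjFun

open ProjFun
theorem mainTheorem3 {k : Type w} [Field k] {Q : Type u} [Quiver.{v} Q] [Fintype Q]
    (hQ : IsAdmissibleTreeQuiver Q) :
    (∃ W : Set (FreeMonoid Q), IsAdmissibleNormalForm k W) ∧
    (∃ φ : PresentedMonoid (WordRel Q) ≃* projMonoid k (PathAlgebra k Q),
      ∀ t : Q, φ (PresentedMonoid.of (WordRel Q) t) = vertexClass k t) ∧
    (∃ ψ : BAlgebra k Q ≃ₐ[k] MonoidAlgebra k (projMonoid k (PathAlgebra k Q)),
      ∀ t : Q, ψ (gen k t) = MonoidAlgebra.of k _ (vertexClass k t)) := by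
  let φ := MulEquiv.ofBijective (presentedHom k hQ.toIsTreeQuiver)
    ⟨presentedHom_injective hQ, presentedHom_surjective hQ.toIsTreeQuiver⟩
  refine ⟨exists_isAdmissibleNormalForm k hQ, ⟨φ, fun t => rfl⟩,
    ⟨(bAlgebraEquiv k Q).trans (MonoidAlgebra.domCongr k k φ), fun t => ?_⟩⟩
  rw [AlgEquiv.trans_apply, bAlgebraEquiv_gen, MonoidAlgebra.of_apply, MonoidAlgebra.of_apply]
  exact MonoidAlgebra.domCongr_single (R := k) φ _ (1 : k)
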